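/- For $r\ge 0$, $\boldsymbol\omega=(\omega_1,\dots,\omega_r)\in\mathbb C^r$ with $\mathrm{Re}(\omega_i)>0$ and $\mathrm{Re}(w)>0$, let $\zeta_r(s,w;\boldsymbol\omega)=\sum_{\boldsymbol n\in\mathbb Z_{\ge0}^r}(\boldsymbol n\cdot\boldsymbol\omega+w)^{-s}$ ($\mathrm{Re}(s)>r$, principal powers) be the Barnes multiple zeta function, continued analytically in $s$ to $\mathbb C\setminus\{1,\dots,r\}$. For integers $m,k\ge0$ put $$\log{}_m\Gamma_{r,k}(w;\boldsymbol\omega)=\left.\frac{\partial^m}{\partial s^m}\zeta_r(s,w;\boldsymbol\omega)\right|_{s=-k},\qquad H_k(\mu)=\sum_{0<j_1\le\cdots\le j_\mu\le k}\frac1{j_1\cdots j_\mu},$$ with $H_k(0)=1$ and $H_0(\mu)=0$ for $\mu\ge1$, and $$c^m_{\mu,k}=\frac{(-1)^k}{k!}\frac{m!}{(m-\mu)!}H_k(\mu)\quad(0\le\mu\le m).$$ The balanced hypermultiple gamma functions of BM-type are $${}_mP_{r,k}(w;\boldsymbol\omega)=\sum_{\mu=0}^m c^m_{m-\mu,k}\,\log{}_\mu\Gamma_{r,k}(w;\boldsymbol\omega)\qquad(k\ge0),$$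 extended to all $k\in\mathbb Z$ by $\frac{\partial}{\partial w}\,{}_mP_{r,k}=-\,{}_mP_{r,k-1}$, that is, ${}_mP_{r,-j}=(-1)^j\frac{\partial^j}{\partial w^j}\,{}_mP_{r,0}$ for $j\ge1$. For $\boldsymbol\alpha=(\alpha_1,\dots,\alpha_l)\in\mathbb C^l$ with $\mathrm{Re}(\alpha_j)>0$, the multiple Bernoulli polynomials $a_{l,N}(x;\boldsymbol\alpha)$ are defined by the Laurent expansion at $t=0$ $$\frac{e^{-xt}}{\prod_{j=1}^l(1-e^{-\alpha_jt})}=\sum_{N=-l}^\infty a_{l,N}(x;\boldsymbol\alpha)\,t^N .$$ **Theorem 1.4.** Let $m,r,l\ge0$ and $k$ be integers, let $\boldsymbol\omega\in\mathbb C^r$ and $\boldsymbol\alpha\in\mathbb C^l$ have all entries of positive real part, and let $a\in\mathbb C$ with $\mathrm{Re}(a)\ge0$. Then, as $|w|\to\infty$ in the half-plane $\mathrm{Re}(w)>0$, $${}_mP_{r+l,k}(w+a;(\boldsymbol\omega,\boldsymbol\alpha))=\sum_{N=-l}^{r+k}a_{l,N}(a;\boldsymbol\alpha)\,{}_mP_{r,k-N}(w;\boldsymbol\omega)+O\!\left(\frac{(\log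 w)^{m-1}}{w}\right),$$ where the sum is empty if $r+k<-l$, and the implied constant may depend on $m,r,l,k,\boldsymbol\omega,\boldsymbol\alpha,a$ but not on $w$. -/

import Mathlib

open Asymptotics

namespace BarnesMilnor

/-- `F` is the analytic continuation in `s` of the Barnes multiple zeta function
`ζ_r(s, w; ω) = ∑_{n ≥ 0} (n · ω + w) ^ (-s)`: it is given by this absolutely convergent series
for `Re s > r`, and it is holomorphic on `ℂ` outside `1, …, r`, the possible poles.
Powers are principal; all the bases have positive real part if `Re w > 0` and `Re (ω i) > 0`. -/
def IsBarnesZeta {r : ℕ} (ω : Fin r → ℂ) (w : ℂ) (F : ℂ → ℂ) : Prop :=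
  DifferentiableOn ℂ F {s : ℂ | ∀ j : ℕ, 1 ≤ j → j ≤ r → s ≠ (j : ℂ)} ∧
    ∀ s : ℂ, (r : ℝ) < s.re →
      HasSum (fun n : Fin r → ℕ => ((∑ i, (n i : ℂ) * ω i) + w) ^ (-s)) (F s)

/-- The continuation is unique away from the possible poles `1, …, r`. -/
theorem IsBarnesZeta.eq {r : ℕ} {ω : Fin r → ℂ} {w : ℂ} {F G : ℂ → ℂ}
    (hF : IsBarnesZeta ω w F) (hG : IsBarnesZeta ω w G) :
    Set.EqOn F G {s : ℂ | ∀ j : ℕ, 1 ≤ j → j ≤ r → s ≠ (j : ℂ)} := by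
  have hset : {s : ℂ | ∀ j : ℕ, 1 ≤ j → j ≤ r → s ≠ (j : ℂ)} =
      ((fun j : ℕ => (j : ℂ)) '' Set.Icc 1 r)ᶜ := by
    ext s
    simp only [Set.mem_ofPred_eq, Set.mem_compl_iff, Set.mem_image, Set.mem_Icc, not_exists,
      not_and, and_imp]
    exact ⟨fun h j h1 h2 h3 => h j h1 h2 h3.symm, fun h j h1 h2 h3 => h j h1 h2 h3.symm⟩
  have hfin : ((fun j : ℕ => (j : ℂ)) '' Set.Icc 1 r).Finite := (Set.finite_Icc 1 r).image _
  have hopen : IsOpen {s : ℂ | ∀ j : ℕ, 1 ≤ j → j ≤ r → s ≠ (j : ℂ)} := by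
    rw [hset]; exact hfin.isClosed.isOpen_compl
  have hconn : IsPreconnected {s : ℂ | ∀ j : ℕ, 1 ≤ j → j ≤ r → s ≠ (j : ℂ)} := by
    rw [hset]
    exact (hfin.countable.isConnected_compl_of_one_lt_rank
      (by rw [Complex.rank_real_complex]; norm_num)).isPreconnected
  have hmem : ((r : ℂ) + 1) ∈ {s : ℂ | ∀ j : ℕ, 1 ≤ j → j ≤ r → s ≠ (j : ℂ)} := by
    intro j _ h2 h3
    have h4 : r + 1 = j := by exact_mod_cast h3
    omega
  refine (hF.1.analyticOnNhd hopen).eqOn_of_preconnected_of_eventuallyEq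
    (hG.1.analyticOnNhd hopen) hconn hmem ?_
  have hhalf : {s : ℂ | (r : ℝ) < s.re} ∈ nhds ((r : ℂ) + 1) :=
    (isOpen_lt continuous_const Complex.continuous_re).mem_nhds (by simp)
  filter_upwards [hhalf] with s hs
  exact (hF.2 s hs).unique (hG.2 s hs)

open Classical in
/-- The Barnes multiple zeta function `s ↦ ζ_r(s, w; ω)`, analytically continued
(its values at the possible poles `s = 1, …, r` are irrelevant). -/
noncomputable def barnesZeta {r : ℕ} (ω : Fin r → ℂ) (w : ℂ) : ℂ → ℂ :=
  if h : ∃ F : ℂ → ℂ, IsBarnesZeta ω w F then h.choose else 0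

/-- The logarithm of the hypermultiple gamma function of BM-type,
`log ₘΓ_{r,k}(w; ω) = ∂_s^m ζ_r(s, w; ω)` at `s = -k`. -/
noncomputable def logHyperGamma (m : ℕ) {r : ℕ} (ω : Fin r → ℂ) (k : ℕ) (w : ℂ) : ℂ :=
  iteratedDeriv m (barnesZeta ω w) (-(k : ℂ))

open Classical in
/-- The multiple harmonic sum `H_k(μ) = ∑_{0 < j_1 ≤ ⋯ ≤ j_μ ≤ k} 1 / (j_1 ⋯ j_μ)`;
so `H_k(0) = 1`, and `H_0(μ) = 0` for `μ ≥ 1`. -/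
noncomputable def multipleHarmonic (k μ : ℕ) : ℂ :=
  ∑ j : Fin μ → Finset.Icc 1 k with Monotone j, ∏ i, ((j i : ℕ) : ℂ)⁻¹

/-- The coefficient `c^m_{μ,k} = ((-1)^k / k!) * (m! / (m - μ)!) * H_k(μ)`, used for `μ ≤ m`. -/
noncomputable def balancingCoeff (m μ k : ℕ) : ℂ :=
  (-1) ^ k / (k.factorial : ℂ) * ((m.factorial : ℂ) / ((m - μ).factorial : ℂ)) *
    multipleHarmonic k μ

/-- The balanced hypermultiple gamma function `ₘP_{r,k}(w; ω)` for an integer `k`.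
For `k ≥ 0` it is `∑_{μ=0}^m c^m_{m-μ,k} log _μΓ_{r,k}(w; ω)`; the hierarchy
`∂_w ₘP_{r,k} = - ₘP_{r,k-1}` extends it to negative `k`. -/
noncomputable def balancedHyperGamma (m : ℕ) {r : ℕ} (ω : Fin r → ℂ) : ℤ → ℂ → ℂ
  | Int.ofNat k => fun w =>
      ∑ μ ∈ Finset.range (m + 1), balancingCoeff m (m - μ) k * logHyperGamma μ ω k w
  | Int.negSucc j => fun w =>
      (-1) ^ (j + 1) * iteratedDeriv (j + 1)
        (fun z => ∑ μ ∈ Finset.range (m + 1),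
          balancingCoeff m (m - μ) 0 * logHyperGamma μ ω 0 z) w

/-- The Taylor series in `t` of `e^{c t}`. -/
noncomputable def expSeries (c : ℂ) : PowerSeries ℂ :=
  PowerSeries.rescale c (PowerSeries.exp ℂ)

/-- The multiple Bernoulli polynomial `a_{l,N}(x; α)`: the coefficient of `t ^ N` in the Laurent
expansion at `t = 0` of `e^{-x t} / ∏_{i=1}^l (1 - e^{-α_i t})`. -/
noncomputable def multipleBernoulli {l : ℕ} (α : Fin l → ℂ) (N : ℤ) (x : ℂ) : ℂ :=
  HahnSeries.coeff
    (((expSeries (-x) : PowerSeries ℂ) : LaurentSeries ℂ) /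
      ∏ i, (1 - ((expSeries (-α i) : PowerSeries ℂ) : LaurentSeries ℂ))) N

end BarnesMilnor

/-! Let K(t) = e^(-a t) / ∏ (1 - e^(-ω_i t)). Geometric series and Euler's integral give Γ(s) ζ_r(s,
w + a; ω) = ∫ t^(s-1) e^(-w t) K(t) dt along a ray. Subtracting the first Laurent terms b_n t^(n-r)
of K continues ζ_r to the left, and each of them contributes b_n w^(-s-n+r) Γ(s+n-r) / Γ(s).

The balancing coefficients are Taylor coefficients: Γ(x-k) / Γ(x) = ∏_{i ≤ k} 1 / (x-i) generates
(-1)^k H_k(μ) / k!. By Leibniz, for k ≥ 0, ₘP_{r,k} is the m-th derivative at x = 0 of ζ_r(x-k)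
Γ(x-k) / Γ(x). In this product a Laurent term turns into b_n w^(q-x) Γ(x-q) / Γ(x) with q = r+k-n,
so r, k, n enter the model function only through q. Writing Λ_q (`logPower`) for the m-th derivative
of that function, ₘP_{r,k}(w+a) is ∑_{0 ≤ q ≤ r+k} b_{r+k-q} Λ_q(w) plus an error
(`Admissible.balancedHyperGamma_eq`). The kernel of (ω, α) is the product of the two kernels
(`bernoulliSeries_append`). Hence, when both sides of the theorem are expanded, the main terms agree
exactly by a Cauchy product (`balancedHyperGamma_expansion_of_direction`).

The error is the m-th derivative at x = 0 of 1/Γ(x) times an integral of size |w|^(-1-Re x).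
Cauchy's estimate on |x| = 1/log|w| costs (log|w|)^m, and the zero of 1/Γ at 0 gives back one
logarithm (`errorTerm_isBigO`). Negative k come from differentiating the case k = 0 in w: Λ_{q+1}' =
-Λ_q, and Cauchy's estimate in w preserves the order of the error (`IsSmall.deriv`).

Along the real ray, e^(-w t) decays only at the rate Re w, which is not uniform up to the imaginary
axis. The ray is therefore tilted to c = 1 ∓ iε, with ε so small that Re(c ω_i) stays positive. Then
Re(c w) ≥ ε|w| in the upper, respectively lower, quadrant, and the two sectors cover the half-plane
(`cobounded_inf_le`). -/

namespace BarnesMilnor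

open Filter Topology MeasureTheory Set

/-! ### Laplace integrals and Euler's integral -/

section Laplace

/-- Differentiation under the integral sign. Half of the gap between b and Re z is kept as decay,
and it absorbs the new factor through t e^(-ε t) ≤ 1/ε. -/
theorem differentiableAt_laplace {φ : ℝ → ℂ} {b : ℝ}
    (hφ : IntegrableOn (fun t : ℝ => Complex.exp (-(b * t)) * φ t) (Ioi 0)) {z : ℂ}
    (hz : b < z.re) :
    DifferentiableAt ℂ (fun z : ℂ => ∫ t in Ioi (0 : ℝ), Complex.exp (-(z * t)) * φ t) z := by
  obtain ⟨ε, hε, hε2⟩ : ∃ ε : ℝ, 0 < ε ∧ b + 2 * ε = z.re := ⟨(z.re - b) / 2, by linarith, by ring⟩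
  have hm : AEStronglyMeasurable φ (volume.restrict (Ioi (0 : ℝ))) := by
    have h := (Continuous.aestronglyMeasurable (f := fun t : ℝ => Complex.exp (b * t))
      (by fun_prop) (μ := volume.restrict (Ioi (0 : ℝ)))).mul hφ.aestronglyMeasurable
    refine h.congr (Eventually.of_forall fun t => ?_)
    simp only [Pi.mul_apply]
    rw [← mul_assoc, ← Complex.exp_add, add_neg_cancel, Complex.exp_zero, one_mul]
  have hexp : ∀ (z' : ℂ) (t : ℝ), Complex.exp (-(z' * t)) * φ t
      = Complex.exp (-((z' - b) * t)) * (Complex.exp (-(b * t)) * φ t) := by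
    intro z' t
    rw [← mul_assoc, ← Complex.exp_add]
    ring_nf
  refine (hasDerivAt_integral_of_dominated_loc_of_deriv_le (𝕜 := ℂ)
    (μ := volume.restrict (Ioi (0 : ℝ)))
    (F := fun (z : ℂ) (t : ℝ) => Complex.exp (-(z * t)) * φ t)
    (F' := fun (z : ℂ) (t : ℝ) => (-t * Complex.exp (-(z * t))) * φ t)
    (bound := fun t => ε⁻¹ * ‖Complex.exp (-(b * t)) * φ t‖)
    (Metric.ball_mem_nhds z hε) ?_ ?_ ?_ ?_ ?_ ?_).2.differentiableAt
  · refine Eventually.of_forall fun z' => AEStronglyMeasurable.mul ?_ hm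
    exact Continuous.aestronglyMeasurable (by fun_prop)
  · refine Integrable.mono hφ (AEStronglyMeasurable.mul
      (Continuous.aestronglyMeasurable (by fun_prop)) hm) ?_
    refine (ae_restrict_mem measurableSet_Ioi).mono fun t ht => ?_
    rw [hexp z t, norm_mul, Complex.norm_exp]
    refine mul_le_of_le_one_left (norm_nonneg _) (Real.exp_le_one_iff.mpr ?_)
    have ht' : (0 : ℝ) < t := ht
    simp only [Complex.neg_re, Complex.mul_re, Complex.sub_re, Complex.ofReal_re, Complex.sub_im,
      Complex.ofReal_im]
    nlinarith
  · exact AEStronglyMeasurable.mul (Continuous.aestronglyMeasurable (by fun_prop)) hm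
  · refine (ae_restrict_mem measurableSet_Ioi).mono fun t ht z' hz' => ?_
    have ht' : (0 : ℝ) < t := ht
    have h1 : b + ε ≤ z'.re := by
      have := (Complex.abs_re_le_norm (z' - z)).trans (mem_ball_iff_norm.mp hz').le
      rw [Complex.sub_re] at this
      have := (abs_le.mp this).1
      linarith
    rw [mul_assoc, hexp, norm_mul, norm_mul, ← mul_assoc]
    refine mul_le_mul_of_nonneg_right ?_ (norm_nonneg _)
    rw [norm_neg, Complex.norm_real, Real.norm_of_nonneg ht'.le, Complex.norm_exp]
    have h2 : (-((z' - b) * t) : ℂ).re ≤ -(ε * t) := by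
      simp only [Complex.neg_re, Complex.mul_re, Complex.sub_re, Complex.ofReal_re, Complex.sub_im,
        Complex.ofReal_im]
      nlinarith
    calc t * Real.exp (-((z' - b) * t) : ℂ).re ≤ t * Real.exp (-(ε * t)) := by gcongr
      _ ≤ ε⁻¹ := by
        rw [Real.exp_neg, ← div_eq_mul_inv, div_le_iff₀ (Real.exp_pos _), ← div_eq_inv_mul,
          le_div_iff₀ hε]
        have := Real.add_one_le_exp (ε * t)
        linarith
  · exact (Integrable.norm hφ).const_mul _
  · refine Eventually.of_forall fun t z' _ => ?_
    have h : HasDerivAt (fun z : ℂ => Complex.exp (-(z * t))) (Complex.exp (-(z' * t)) * -(1 * t)) z' :=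
      (((hasDerivAt_id' z').mul_const (t : ℂ)).neg).cexp
    exact (h.mul_const (φ t)).congr_deriv (by ring)

theorem integrableOn_cpow_mul_exp {s : ℂ} (hs : 0 < s.re) {z : ℂ} (hz : 0 < z.re) :
    IntegrableOn (fun t : ℝ => Complex.exp (-(z * t)) * (t : ℂ) ^ (s - 1)) (Ioi 0) := by
  have h := mellinConvergent_of_isBigO_rpow_exp (a := z.re) (b := 0) hz (s := s)
    (f := fun t : ℝ => Complex.exp (-(z * t))) ?_ ?_ ?_ hs
  · refine h.congr_fun (fun t _ => ?_) measurableSet_Ioi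
    simp only [smul_eq_mul]
    ring
  · exact (Continuous.continuousOn (by fun_prop)).locallyIntegrableOn measurableSet_Ioi
  · refine IsBigO.of_bound 1 (Eventually.of_forall fun t => ?_)
    rw [Complex.norm_exp, one_mul, Real.norm_of_nonneg (Real.exp_pos _).le]
    simp
  · refine IsBigO.of_bound 1 (eventually_mem_nhdsWithin.mono fun t ht => ?_)
    have ht' : (0 : ℝ) < t := ht
    rw [Complex.norm_exp]
    simp only [neg_zero, Real.rpow_zero, norm_one, mul_one]
    refine Real.exp_le_one_iff.mpr ?_
    simp only [Complex.neg_re, Complex.mul_re, Complex.ofReal_re, Complex.ofReal_im]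
    nlinarith

/-- Euler's integral `∫ e ^ (-z t) t ^ (s - 1) dt = z ^ (-s) Γ(s)` for complex `z`, `Re z > 0`. -/
theorem integral_exp_mul_cpow {s : ℂ} (hs : 0 < s.re) {z : ℂ} (hz : 0 < z.re) :
    ∫ t in Ioi (0 : ℝ), Complex.exp (-(z * t)) * (t : ℂ) ^ (s - 1)
      = z ^ (-s) * Complex.Gamma s := by
  have hopen : IsOpen {z : ℂ | 0 < z.re} := isOpen_lt continuous_const Complex.continuous_re
  have h1 : DifferentiableOn ℂ
      (fun z : ℂ => ∫ t in Ioi (0 : ℝ), Complex.exp (-(z * t)) * (t : ℂ) ^ (s - 1))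
      {z : ℂ | 0 < z.re} := fun z hz => by
    have hz' : 0 < z.re := hz
    refine (differentiableAt_laplace (b := z.re / 2) ?_ (by linarith)).differentiableWithinAt
    exact integrableOn_cpow_mul_exp hs (by rw [Complex.ofReal_re]; linarith)
  have h2 : DifferentiableOn ℂ (fun z : ℂ => z ^ (-s) * Complex.Gamma s) {z : ℂ | 0 < z.re} :=
    fun z hz => ((differentiableAt_id.cpow_const (Or.inl hz)).mul_const _).differentiableWithinAt
  refine (h1.analyticOnNhd hopen).eqOn_of_preconnected_of_frequently_eq (h2.analyticOnNhd hopen)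
    (convex_halfSpace_re_gt 0).isPreconnected (z₀ := 1) (by simp) ?_ hz
  -- Both sides are holomorphic on the half-plane. They agree at real points greater than 1, which
  -- accumulate at 1, so the identity theorem applies.
  have htend : Tendsto (fun x : ℝ => (x : ℂ)) (𝓝[>] 1) (𝓝[≠] 1) := by
    refine tendsto_nhdsWithin_of_tendsto_nhds_of_eventually_within _ ?_ ?_
    · exact ((Complex.continuous_ofReal.tendsto 1).mono_left nhdsWithin_le_nhds).congr'
        (Eventually.of_forall fun _ => rfl) |>.trans (by simp)
    · filter_upwards [self_mem_nhdsWithin] with x hx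
      have : (1 : ℝ) < x := hx
      simp only [mem_compl_iff, mem_singleton_iff]
      exact_mod_cast this.ne'
  refine htend.frequently (Eventually.frequently ?_)
  filter_upwards [self_mem_nhdsWithin] with x hx
  have hx' : (1 : ℝ) < x := hx
  have h := Complex.integral_cpow_mul_exp_neg_mul_Ioi hs (zero_lt_one.trans hx')
  rw [one_div, Complex.inv_cpow _ _ ?_, ← Complex.cpow_neg] at h
  · rw [← h]
    exact setIntegral_congr_fun measurableSet_Ioi fun t _ => mul_comm _ _
  · rw [Complex.arg_ofReal_of_nonneg (by linarith)]
    exact Real.pi_pos.ne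

theorem integral_real_exp_mul_rpow {x : ℝ} (hx : 0 < x) {y : ℝ} (hy : 0 < y) :
    ∫ t in Ioi (0 : ℝ), Real.exp (-(y * t)) * t ^ (x - 1) = y ^ (-x) * Real.Gamma x := by
  have h := Real.integral_rpow_mul_exp_neg_mul_Ioi hx hy
  rw [one_div, Real.inv_rpow hy.le, ← Real.rpow_neg hy.le] at h
  rw [← h]
  exact setIntegral_congr_fun measurableSet_Ioi fun t _ => mul_comm _ _

end Laplace

/-! ### Mellin transforms with controlled growth -/

/-- Continuous functions on `(0, ∞)` that decay rapidly at `∞` and are `O(t ^ (-b))` at `0` for every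
`b > b₀`. -/
structure MellinClass (b₀ : ℝ) (f : ℝ → ℂ) : Prop where
  cont : ContinuousOn f (Ioi 0)
  top : ∀ a : ℝ, f =O[atTop] (· ^ (-a) : ℝ → ℝ)
  bot : ∀ b : ℝ, b₀ < b → f =O[𝓝[>] 0] (· ^ (-b) : ℝ → ℝ)

namespace MellinClass

variable {b₀ : ℝ} {f : ℝ → ℂ}

theorem locallyIntegrableOn (hf : MellinClass b₀ f) : LocallyIntegrableOn f (Ioi 0) :=
  hf.cont.locallyIntegrableOn measurableSet_Ioi

theorem mellinConvergent (hf : MellinClass b₀ f) {s : ℂ} (hs : b₀ < s.re) :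
    MellinConvergent f s := by
  obtain ⟨b, hb, hb'⟩ := exists_between hs
  exact mellinConvergent_of_isBigO_rpow hf.locallyIntegrableOn (hf.top (s.re + 1)) (by linarith)
    (hf.bot b hb) hb'

/-- Asking for every a and every b > b₀ leaves room for this: an arbitrarily small loss in the
exponent pays for a logarithm. Stability under logarithms gives all derivatives of the Mellin
transform. -/
theorem log_smul (hf : MellinClass b₀ f) : MellinClass b₀ (fun t => Real.log t • f t) where
  cont := ContinuousOn.smul (Real.continuousOn_log.mono fun t ht => ne_of_gt ht) hf.cont
  top a := isBigO_rpow_top_log_smul (lt_add_one a) (hf.top (a + 1))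
  bot b hb := by
    obtain ⟨b', hb', hb''⟩ := exists_between hb
    exact isBigO_rpow_zero_log_smul hb'' (hf.bot b' hb')

theorem log_pow_smul (hf : MellinClass b₀ f) (n : ℕ) :
    MellinClass b₀ (fun t => Real.log t ^ n • f t) := by
  induction n with
  | zero => simpa using hf
  | succ n ih => simpa only [pow_succ', mul_smul] using ih.log_smul

theorem hasDerivAt_mellin (hf : MellinClass b₀ f) {s : ℂ} (hs : b₀ < s.re) :
    HasDerivAt (mellin f) (mellin (fun t => Real.log t • f t) s) s := by
  obtain ⟨b, hb, hb'⟩ := exists_between hs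
  exact (mellin_hasDerivAt_of_isBigO_rpow hf.locallyIntegrableOn (hf.top (s.re + 1)) (by linarith)
    (hf.bot b hb) hb').2

theorem differentiableOn_mellin (hf : MellinClass b₀ f) :
    DifferentiableOn ℂ (mellin f) {s : ℂ | b₀ < s.re} := fun _ hs =>
  (hf.hasDerivAt_mellin hs).differentiableAt.differentiableWithinAt

theorem iteratedDeriv_mellin (hf : MellinClass b₀ f) (n : ℕ) {s : ℂ} (hs : b₀ < s.re) :
    iteratedDeriv n (mellin f) s = mellin (fun t => Real.log t ^ n • f t) s := by
  induction n generalizing s with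
  | zero => simp
  | succ n ih =>
    rw [iteratedDeriv_succ]
    have hev : iteratedDeriv n (mellin f) =ᶠ[𝓝 s] mellin (fun t => Real.log t ^ n • f t) := by
      filter_upwards [(isOpen_lt continuous_const Complex.continuous_re).mem_nhds hs] with z hz
      exact ih hz
    rw [hev.deriv_eq, ((hf.log_pow_smul n).hasDerivAt_mellin hs).deriv]
    simp only [pow_succ', mul_smul]

end MellinClass

/-- `f` is continuous on `(0, ∞)` and bounded by `C t ^ d e ^ (B t)`. -/
structure ExpPowBound (C d B : ℝ) (f : ℝ → ℂ) : Prop where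
  cont : ContinuousOn f (Ioi 0)
  bound : ∀ t : ℝ, 0 < t → ‖f t‖ ≤ C * (t ^ d * Real.exp (B * t))

namespace ExpPowBound

variable {C d B : ℝ} {f : ℝ → ℂ}

theorem mellinClass (hf : ExpPowBound C d B f) {z : ℂ} (hz : B < z.re) :
    MellinClass (-d) (fun t : ℝ => Complex.exp (-(z * t)) * f t) where
  cont := ContinuousOn.mul (Continuous.continuousOn (by fun_prop)) hf.cont
  top a := by
    have h1 : (fun t : ℝ => Complex.exp (-(z * t)) * f t)
        =O[atTop] (fun t : ℝ => t ^ d * Real.exp (-(z.re - B) * t)) := by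
      refine IsBigO.of_bound C ((eventually_gt_atTop 0).mono fun t ht => ?_)
      rw [norm_mul, Complex.norm_exp, Real.norm_of_nonneg (by positivity)]
      have h2 : (-(z * t) : ℂ).re = -(z.re - B) * t + -(B * t) := by simp; ring
      rw [h2, Real.exp_add, mul_assoc]
      have h3 : Real.exp (-(B * t)) * ‖f t‖ ≤ C * t ^ d := by
        rw [Real.exp_neg, ← div_eq_inv_mul, div_le_iff₀ (Real.exp_pos _), mul_assoc]
        exact hf.bound t ht
      calc _ ≤ Real.exp (-(z.re - B) * t) * (C * t ^ d) := by gcongr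
        _ = _ := by ring
    have h4 := (isLittleO_exp_neg_mul_rpow_atTop (sub_pos.mpr hz) (-d - a)).isBigO
    refine h1.trans (((isBigO_refl (fun t : ℝ => t ^ d) atTop).mul h4).congr' EventuallyEq.rfl ?_)
    filter_upwards [eventually_gt_atTop 0] with t ht
    rw [← Real.rpow_add ht]
    ring_nf
  bot b hb := by
    refine IsBigO.of_bound (C * Real.exp (|z.re - B|)) ?_
    filter_upwards [Ioo_mem_nhdsGT one_pos] with t ht
    have ht0 : 0 < t := ht.1
    rw [norm_mul, Complex.norm_exp, Real.norm_of_nonneg (by positivity)]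
    have hC : 0 ≤ C := by
      have := (norm_nonneg _).trans (hf.bound 1 one_pos)
      rw [Real.one_rpow, one_mul] at this
      exact nonneg_of_mul_nonneg_left this (Real.exp_pos _)
    have h2 : (-(z * t) : ℂ).re + B * t ≤ |z.re - B| := by
      simp only [Complex.neg_re, Complex.mul_re, Complex.ofReal_re, Complex.ofReal_im]
      have := abs_nonneg (z.re - B)
      have := ht.2
      cases abs_cases (z.re - B) <;> nlinarith
    calc _ ≤ Real.exp (-(z * t) : ℂ).re * (C * (t ^ d * Real.exp (B * t))) := by
          gcongr; exact hf.bound t ht0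
      _ = C * Real.exp ((-(z * t) : ℂ).re + B * t) * t ^ d := by rw [Real.exp_add]; ring
      _ ≤ C * Real.exp (|z.re - B|) * t ^ (-b) := by
          have h5 : t ^ d ≤ t ^ (-b) :=
            Real.rpow_le_rpow_of_exponent_ge ht0 ht.2.le (by linarith)
          have h6 := Real.exp_le_exp.mpr h2
          gcongr

/-- Taking absolute values leaves a real Euler integral. The explicit power of Re z - B is the
source of the decay in w. -/
theorem norm_mellin_le (hf : ExpPowBound C d B f) {z : ℂ} (hz : B < z.re) {s : ℂ}
    (hs : -d < s.re) :
    ‖mellin (fun t : ℝ => Complex.exp (-(z * t)) * f t) s‖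
      ≤ C * ((z.re - B) ^ (-(s.re + d)) * Real.Gamma (s.re + d)) := by
  rw [← integral_real_exp_mul_rpow (by linarith) (sub_pos.mpr hz), ← integral_const_mul, mellin]
  have hint : IntegrableOn (fun t : ℝ => ‖Complex.exp (-((z.re - B : ℝ) * t)) *
      (t : ℂ) ^ (((s.re + d : ℝ) : ℂ) - 1)‖) (Ioi 0) := (integrableOn_cpow_mul_exp (s := (s.re + d : ℝ))
    (z := (z.re - B : ℝ)) (by rw [Complex.ofReal_re]; linarith)
    (by rw [Complex.ofReal_re]; linarith)).norm
  refine norm_integral_le_of_norm_le (Integrable.const_mul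
    (hint.congr_fun (fun t ht => ?_) measurableSet_Ioi) C)
    ((ae_restrict_mem measurableSet_Ioi).mono fun t ht => ?_)
  · have ht' : (0 : ℝ) < t := ht
    simp only
    rw [norm_mul, Complex.norm_exp, Complex.norm_cpow_eq_rpow_re_of_pos ht']
    simp
  · have ht' : (0 : ℝ) < t := ht
    rw [norm_smul, norm_mul, Complex.norm_exp, Complex.norm_cpow_eq_rpow_re_of_pos ht']
    have h2 : (-(z * t) : ℂ).re = -((z.re - B) * t) + -(B * t) := by simp; ring
    have h3 : (s - 1).re = s.re - 1 := by simp
    have h4 : s.re + d - 1 = (s.re - 1) + d := by ring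
    rw [h2, h3, h4, Real.rpow_add ht', Real.exp_add]
    calc _ ≤ t ^ (s.re - 1) * (Real.exp (-((z.re - B) * t)) * Real.exp (-(B * t)) *
            (C * (t ^ d * Real.exp (B * t)))) := by gcongr; exact hf.bound t ht'
      _ = C * (Real.exp (-((z.re - B) * t)) * (t ^ (s.re - 1) * t ^ d))
            * (Real.exp (-(B * t)) * Real.exp (B * t)) := by ring
      _ = _ := by rw [← Real.exp_add, neg_add_cancel, Real.exp_zero, mul_one]

theorem differentiableAt_mellin_log_pow (hf : ExpPowBound C d B f) (n : ℕ) {s : ℂ}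
    (hs : -d < s.re) {z : ℂ} (hz : B < z.re) :
    DifferentiableAt ℂ (fun z : ℂ =>
      mellin (fun t : ℝ => Real.log t ^ n • (Complex.exp (-(z * t)) * f t)) s) z := by
  obtain ⟨b, hb, hb'⟩ := exists_between hz
  have hint := ((hf.mellinClass (z := (b : ℂ)) (by simpa using hb)).log_pow_smul n).mellinConvergent hs
  have h := differentiableAt_laplace (φ := fun t : ℝ => (t : ℂ) ^ (s - 1) *
    (Real.log t ^ n • f t)) (b := b) (z := z) ?_ hb'
  · refine h.congr_of_eventuallyEq (Eventually.of_forall fun z => ?_)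
    refine setIntegral_congr_fun measurableSet_Ioi fun t _ => ?_
    simp only [smul_eq_mul, Complex.real_smul]
    ring
  · refine hint.congr_fun (fun t _ => ?_) measurableSet_Ioi
    simp only [smul_eq_mul, Complex.real_smul]
    ring

end ExpPowBound

end BarnesMilnor

/-! ### Asymptotic expansions at 0 and Bernoulli series -/

namespace BarnesMilnor

open Filter Topology MeasureTheory Set

/-- `h` has the asymptotic expansion `p` at `0`. -/
def HasExpansion (h : ℂ → ℂ) (p : PowerSeries ℂ) : Prop :=
  ∀ n : ℕ, (fun t => h t - (PowerSeries.trunc n p).eval t) =O[𝓝[≠] 0] (fun t => t ^ n)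

theorem isBigO_eval_of_X_pow_dvd {q : Polynomial ℂ} {n : ℕ} (h : Polynomial.X ^ n ∣ q) :
    (fun t => q.eval t) =O[𝓝[≠] 0] (fun t : ℂ => t ^ n) := by
  obtain ⟨q', rfl⟩ := h
  have h1 : (fun t => q'.eval t) =O[𝓝[≠] (0 : ℂ)] (fun _ => (1 : ℂ)) :=
    ((q'.continuous.tendsto 0).mono_left nhdsWithin_le_nhds).isBigO_one ℂ
  simpa using (isBigO_refl (fun t : ℂ => t ^ n) (𝓝[≠] 0)).mul h1

/-- Truncation is multiplicative modulo X^n; this carries products and inverses of formal series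
over to expansions. -/
theorem X_pow_dvd_trunc_mul (p q : PowerSeries ℂ) (n : ℕ) :
    (Polynomial.X ^ n : Polynomial ℂ) ∣
      PowerSeries.trunc n p * PowerSeries.trunc n q - PowerSeries.trunc n (p * q) := by
  rw [Polynomial.X_pow_dvd_iff]
  intro d hd
  rw [Polynomial.coeff_sub, PowerSeries.coeff_trunc, if_pos hd,
    PowerSeries.coeff_mul_eq_coeff_trunc_mul_trunc p q hd, ← Polynomial.coeff_coe,
    Polynomial.coe_mul, sub_self]

namespace HasExpansion

variable {h h₁ h₂ : ℂ → ℂ} {p p₁ p₂ : PowerSeries ℂ}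

theorem congr (H : HasExpansion h₁ p) (e : ∀ t, t ≠ 0 → h₁ t = h₂ t) : HasExpansion h₂ p :=
  fun n => (H n).congr' (eventually_mem_nhdsWithin.mono fun t ht => by
    simp only [e t ht]) EventuallyEq.rfl

theorem isBigO_one (H : HasExpansion h p) : h =O[𝓝[≠] 0] (fun _ => (1 : ℂ)) := by
  simpa using H 0

theorem mul (H₁ : HasExpansion h₁ p₁) (H₂ : HasExpansion h₂ p₂) :
    HasExpansion (fun t => h₁ t * h₂ t) (p₁ * p₂) := fun n => by
  have e1 := ((H₁ n).mul H₂.isBigO_one).congr_right fun t => mul_one _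
  have e2 : (fun t => (PowerSeries.trunc n p₁).eval t) =O[𝓝[≠] (0 : ℂ)] (fun _ => (1 : ℂ)) :=
    (((PowerSeries.trunc n p₁).continuous.tendsto 0).mono_left nhdsWithin_le_nhds).isBigO_one ℂ
  have e3 := (e2.mul (H₂ n)).congr_right fun t => one_mul _
  have e4 := isBigO_eval_of_X_pow_dvd (X_pow_dvd_trunc_mul p₁ p₂ n)
  refine ((e1.add e3).add e4).congr_left fun t => ?_
  simp only [Polynomial.eval_sub, Polynomial.eval_mul]
  ring

theorem tendsto (H : HasExpansion h p) : Tendsto h (𝓝[≠] 0) (𝓝 (PowerSeries.constantCoeff p)) := by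
  have h1 := (H 1).trans_tendsto
    (((continuous_pow 1).tendsto' (0 : ℂ) 0 (by simp)).mono_left nhdsWithin_le_nhds)
  have h2 := h1.add_const (PowerSeries.constantCoeff p)
  rw [zero_add] at h2
  refine h2.congr fun t => ?_
  rw [PowerSeries.trunc_one_left]
  simp

/-- With q the truncation of p⁻¹, one has h⁻¹ - q = -h⁻¹ (h q - 1), where h⁻¹ is bounded near 0 and
h q - 1 is O(t^n). -/
theorem inv (H : HasExpansion h p) (hp : PowerSeries.constantCoeff p ≠ 0) :
    HasExpansion (fun t => (h t)⁻¹) p⁻¹ := fun n => by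
  have hne : ∀ᶠ t in 𝓝[≠] (0 : ℂ), h t ≠ 0 := H.tendsto.eventually_ne hp
  have e1 : (fun t => (h t)⁻¹) =O[𝓝[≠] (0 : ℂ)] (fun _ => (1 : ℂ)) :=
    (H.tendsto.inv₀ hp).isBigO_one ℂ
  have e2 : (fun t => (PowerSeries.trunc n p⁻¹).eval t) =O[𝓝[≠] (0 : ℂ)] (fun _ => (1 : ℂ)) :=
    (((PowerSeries.trunc n p⁻¹).continuous.tendsto 0).mono_left nhdsWithin_le_nhds).isBigO_one ℂ
  have e3 := ((H n).mul e2).congr_right fun t => mul_one _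
  have e4 := isBigO_eval_of_X_pow_dvd (X_pow_dvd_trunc_mul p p⁻¹ n)
  rw [PowerSeries.mul_inv_cancel p hp] at e4
  -- The truncation of 1 at order 0 is 0 rather than 1, hence the separate case.
  have e5 : (fun t => (PowerSeries.trunc n (1 : PowerSeries ℂ)).eval t - 1)
      =O[𝓝[≠] 0] (fun t : ℂ => t ^ n) := by
    rcases n with _ | n
    · simpa using isBigO_refl (fun _ : ℂ => (1 : ℂ)) (𝓝[≠] 0)
    · simp only [PowerSeries.trunc_one, Polynomial.eval_one, sub_self]
      exact isBigO_zero _ _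
  have e6 := (e1.mul ((e3.add e4).add e5)).neg_left.congr_right fun t => one_mul _
  refine e6.congr' (hne.mono fun t ht => ?_) EventuallyEq.rfl
  simp only [Polynomial.eval_sub, Polynomial.eval_mul]
  field_simp
  ring

theorem one : HasExpansion (fun _ => 1) 1 := fun n => by
  rcases n with _ | n
  · simpa using isBigO_refl (fun _ : ℂ => (1 : ℂ)) (𝓝[≠] 0)
  · simp only [PowerSeries.trunc_one, Polynomial.eval_one, sub_self]
    exact isBigO_zero _ _

theorem prod {r : ℕ} {h : Fin r → ℂ → ℂ} {p : Fin r → PowerSeries ℂ}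
    (H : ∀ i, HasExpansion (h i) (p i)) : HasExpansion (fun t => ∏ i, h i t) (∏ i, p i) := by
  induction r with
  | zero => simpa using one
  | succ r ih =>
    simp only [Fin.prod_univ_succ]
    exact (H 0).mul (ih fun i => H i.succ)

end HasExpansion

theorem coeff_expSeries (c : ℂ) (n : ℕ) :
    PowerSeries.coeff n (expSeries c) = c ^ n / n.factorial := by
  simp [expSeries, PowerSeries.coeff_rescale, PowerSeries.coeff_exp, div_eq_mul_inv]

theorem eval_trunc (p : PowerSeries ℂ) (n : ℕ) (t : ℂ) :
    (PowerSeries.trunc n p).eval t = ∑ i ∈ Finset.range n, PowerSeries.coeff i p * t ^ i :=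
  PowerSeries.eval₂_trunc_eq_sum_range t (RingHom.id ℂ) n p

theorem hasExpansion_exp (c : ℂ) : HasExpansion (fun t => Complex.exp (c * t)) (expSeries c) :=
  fun n => by
  have h1 : Tendsto (fun t : ℂ => c * t) (𝓝[≠] 0) (𝓝 0) :=
    ((continuous_const.mul continuous_id).tendsto' 0 0 (by simp)).mono_left nhdsWithin_le_nhds
  have h2 := (Complex.exp_sub_sum_range_isBigO_pow n).comp_tendsto h1
  have h3 : (fun t : ℂ => (c * t) ^ n) =O[𝓝[≠] 0] (fun t => t ^ n) := by
    simp only [mul_pow]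
    exact isBigO_const_mul_self _ _ _
  refine (h2.trans h3).congr_left fun t => ?_
  simp only [Function.comp_apply, eval_trunc, coeff_expSeries]
  congr 1
  refine Finset.sum_congr rfl fun i _ => ?_
  ring

/-- The Taylor series of `(1 - e ^ (-α t)) / t`. -/
noncomputable def oneSubExpDiv (α : ℂ) : PowerSeries ℂ :=
  PowerSeries.mk fun n => PowerSeries.coeff (n + 1) (1 - expSeries (-α))

theorem one_sub_expSeries (α : ℂ) :
    1 - expSeries (-α) = PowerSeries.X * oneSubExpDiv α := by
  have h := PowerSeries.sub_const_eq_X_mul_shift (1 - expSeries (-α))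
  have h0 : PowerSeries.constantCoeff (1 - expSeries (-α)) = 0 := by
    rw [map_sub, map_one, ← PowerSeries.coeff_zero_eq_constantCoeff_apply, coeff_expSeries]
    simp
  rwa [h0, map_zero, sub_zero] at h

theorem constantCoeff_oneSubExpDiv (α : ℂ) :
    PowerSeries.constantCoeff (oneSubExpDiv α) = α := by
  rw [← PowerSeries.coeff_zero_eq_constantCoeff_apply, oneSubExpDiv, PowerSeries.coeff_mk,
    map_sub, coeff_expSeries]
  simp [PowerSeries.coeff_one]

theorem hasExpansion_oneSubExpDiv (α : ℂ) :
    HasExpansion (fun t => (1 - Complex.exp (-α * t)) / t) (oneSubExpDiv α) := fun n => by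
  -- One extra order is taken because the division by t loses it.
  have h1 := hasExpansion_exp (-α) (n + 1)
  have h2 := (h1.mul (isBigO_refl (fun t : ℂ => t⁻¹) (𝓝[≠] 0))).neg_left
  refine h2.congr' (eventually_mem_nhdsWithin.mono fun t ht => ?_)
    (eventually_mem_nhdsWithin.mono fun t ht => ?_)
  · have ht' : t ≠ 0 := ht
    simp only [eval_trunc, Finset.sum_range_succ', oneSubExpDiv, PowerSeries.coeff_mk, map_sub,
      PowerSeries.coeff_one]
    simp only [Nat.add_eq_zero_iff, one_ne_zero, and_false, if_false, zero_sub, neg_mul,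
      Finset.sum_neg_distrib, coeff_expSeries, pow_zero, Nat.factorial_zero, Nat.cast_one]
    have h3 : ∑ x ∈ Finset.range n, (-α) ^ (x + 1) / ((x + 1).factorial : ℂ) * t ^ (x + 1)
        = t * ∑ x ∈ Finset.range n, (-α) ^ (x + 1) / ((x + 1).factorial : ℂ) * t ^ x := by
      rw [Finset.mul_sum]
      exact Finset.sum_congr rfl fun i _ => by ring
    rw [h3]
    field_simp
    ring
  · have ht' : t ≠ 0 := ht
    change t ^ (n + 1) * t⁻¹ = t ^ n
    rw [pow_succ, mul_assoc, mul_inv_cancel₀ ht', mul_one]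

/-- The Taylor series of `t ^ r e ^ (-a t) / ∏ (1 - e ^ (-ω_i t))`. -/
noncomputable def bernoulliSeries {r : ℕ} (ω : Fin r → ℂ) (a : ℂ) : PowerSeries ℂ :=
  expSeries (-a) * ∏ i, (oneSubExpDiv (ω i))⁻¹

/-- The function `e ^ (-a t) / ∏ (1 - e ^ (-ω_i t))`. -/
noncomputable def barnesKernel {r : ℕ} (ω : Fin r → ℂ) (a : ℂ) (t : ℂ) : ℂ :=
  Complex.exp (-a * t) * ∏ i, (1 - Complex.exp (-ω i * t))⁻¹

theorem hasExpansion_barnesKernel {r : ℕ} {ω : Fin r → ℂ} (hω : ∀ i, ω i ≠ 0) (a : ℂ) :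
    HasExpansion (fun t => t ^ r * barnesKernel ω a t) (bernoulliSeries ω a) := by
  refine ((hasExpansion_exp (-a)).mul (HasExpansion.prod fun i =>
    (hasExpansion_oneSubExpDiv (ω i)).inv (by rw [constantCoeff_oneSubExpDiv]; exact hω i))).congr
    fun t ht => ?_
  have h : ∀ i, ((1 - Complex.exp (-ω i * t)) / t)⁻¹ = t * (1 - Complex.exp (-ω i * t))⁻¹ :=
    fun i => by rw [inv_div, div_eq_mul_inv]
  simp only [barnesKernel, h, Finset.prod_mul_distrib, Finset.prod_const, Finset.card_univ,
    Fintype.card_fin]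
  ring

/-- Each 1 - e^(-ω_i t) is t times a series with constant term ω_i ≠ 0, so inverting the product
only costs t^(-r). This links the formal Laurent coefficients to the expansion of the kernel as a
function. -/
theorem laurent_eq {r : ℕ} {ω : Fin r → ℂ} (hω : ∀ i, ω i ≠ 0) (a : ℂ) :
    (((expSeries (-a) : PowerSeries ℂ) : LaurentSeries ℂ) /
      ∏ i, (1 - ((expSeries (-ω i) : PowerSeries ℂ) : LaurentSeries ℂ))) =
      HahnSeries.single (-(r : ℤ)) (1 : ℂ) * (bernoulliSeries ω a : LaurentSeries ℂ) := by
  have h1 : ∀ i, (1 - ((expSeries (-ω i) : PowerSeries ℂ) : LaurentSeries ℂ)) =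
      HahnSeries.single (1 : ℤ) (1 : ℂ) * (oneSubExpDiv (ω i) : LaurentSeries ℂ) := fun i => by
    rw [← PowerSeries.coe_X, ← PowerSeries.coe_mul, ← one_sub_expSeries, PowerSeries.coe_sub,
      PowerSeries.coe_one]
  have hc : ∀ i, PowerSeries.constantCoeff (oneSubExpDiv (ω i)) ≠ 0 := fun i => by
    rw [constantCoeff_oneSubExpDiv]; exact hω i
  have h2 : ∀ i, (((oneSubExpDiv (ω i))⁻¹ : PowerSeries ℂ) : LaurentSeries ℂ) =
      ((oneSubExpDiv (ω i) : PowerSeries ℂ) : LaurentSeries ℂ)⁻¹ := fun i => by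
    refine eq_inv_of_mul_eq_one_left ?_
    rw [← PowerSeries.coe_mul, PowerSeries.inv_mul_cancel _ (hc i), PowerSeries.coe_one]
  have h3 : (((∏ i, (oneSubExpDiv (ω i))⁻¹ : PowerSeries ℂ)) : LaurentSeries ℂ) =
      ∏ i, ((oneSubExpDiv (ω i) : PowerSeries ℂ) : LaurentSeries ℂ)⁻¹ := by
    simp only [← h2]
    exact map_prod (HahnSeries.ofPowerSeries ℤ ℂ) _ _
  simp only [h1, Finset.prod_mul_distrib, Finset.prod_const, Finset.card_univ, Fintype.card_fin,
    HahnSeries.single_pow, bernoulliSeries, PowerSeries.coe_mul, h3, Finset.prod_inv_distrib]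
  have h4 : (HahnSeries.single (r • (1 : ℤ)) ((1 : ℂ) ^ r))⁻¹ = HahnSeries.single (-(r : ℤ)) (1 : ℂ) := by
    rw [HahnSeries.inv_single]
    simp
  rw [div_eq_mul_inv, mul_inv, h4]
  ring

theorem multipleBernoulli_eq_coeff {r : ℕ} {ω : Fin r → ℂ} (hω : ∀ i, ω i ≠ 0) (a : ℂ) (n : ℕ) :
    multipleBernoulli ω ((n : ℤ) - r) a = PowerSeries.coeff n (bernoulliSeries ω a) := by
  rw [multipleBernoulli, laurent_eq hω, HahnSeries.coeff_single_mul, one_mul,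
    PowerSeries.coeff_coe, if_neg (by omega)]
  congr 1
  congr 1
  omega

/-- The algebraic core of the theorem: the kernel factors, and the whole shift a can be put on the α
factor. -/
theorem bernoulliSeries_append {r l : ℕ} (ω : Fin r → ℂ) (α : Fin l → ℂ) (a : ℂ) :
    bernoulliSeries (Fin.append ω α) a = bernoulliSeries ω 0 * bernoulliSeries α a := by
  have h : expSeries (-0) = 1 := by
    ext n
    rw [coeff_expSeries, PowerSeries.coeff_one]
    rcases n with _ | n <;> simp
  simp only [bernoulliSeries, h, Fin.prod_univ_add, Fin.append_left, Fin.append_right]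
  ring

end BarnesMilnor

/-! ### Bounds for the kernel and its Laurent remainder on a ray -/

namespace BarnesMilnor

open Filter Topology MeasureTheory Set

variable {r : ℕ} {ω : Fin r → ℂ} {a c : ℂ}

/-- From e^y ≥ 1 + y with y = Re x: |1 - e^(-x)| ≥ 1 - 1/(1+y) = y/(1+y). -/
theorem norm_inv_one_sub_exp_le {x : ℂ} (hx : 0 < x.re) :
    ‖(1 - Complex.exp (-x))⁻¹‖ ≤ 1 + x.re⁻¹ := by
  have h1 : x.re / (1 + x.re) ≤ ‖1 - Complex.exp (-x)‖ := by
    have h2 := norm_sub_norm_le (1 : ℂ) (Complex.exp (-x))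
    rw [norm_one, Complex.norm_exp, Complex.neg_re, Real.exp_neg] at h2
    refine le_trans ?_ h2
    have h3 : (Real.exp x.re)⁻¹ ≤ (1 + x.re)⁻¹ := by
      have := Real.add_one_le_exp x.re
      gcongr
      linarith
    have h4 : x.re / (1 + x.re) = 1 - (1 + x.re)⁻¹ := by field_simp; ring
    linarith
  rw [norm_inv]
  calc ‖1 - Complex.exp (-x)‖⁻¹ ≤ (x.re / (1 + x.re))⁻¹ := by gcongr
    _ = 1 + x.re⁻¹ := by field_simp; ring

theorem one_sub_exp_ne_zero {x : ℂ} (hx : 0 < x.re) : 1 - Complex.exp (-x) ≠ 0 := by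
  intro h
  have h1 : ‖Complex.exp (-x)‖ = 1 := by rw [← sub_eq_zero.mp h, norm_one]
  rw [Complex.norm_exp, Real.exp_eq_one_iff, Complex.neg_re] at h1
  linarith

/-- With ρ = Re(c ω_i), each factor is at most 1 + 1/(ρu) = (u + 1/ρ)/u ≤ max(1, 1/ρ) u⁻¹ e^u. The r
factors give u^(-r) e^(ru), and the exponential in a gives the rest of the rate. -/
theorem expPowBound_barnesKernel (hω : ∀ i, 0 < (c * ω i).re) (a : ℂ) :
    ∃ C, ExpPowBound C (-(r : ℝ)) (‖c * a‖ + r) (fun u : ℝ => barnesKernel ω a (c * u)) := by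
  refine ⟨∏ i, max 1 ((c * ω i).re)⁻¹, ⟨?_, fun u hu => ?_⟩⟩
  · refine ContinuousOn.mul (Continuous.continuousOn (by fun_prop))
      (continuousOn_finsetProd _ fun i _ => ContinuousOn.inv₀
        (Continuous.continuousOn (by fun_prop)) fun u hu => ?_)
    have hu' : (0 : ℝ) < u := hu
    have : -ω i * (c * u) = -(c * ω i * u) := by ring
    rw [this]
    refine one_sub_exp_ne_zero ?_
    rw [Complex.re_mul_ofReal]
    exact mul_pos (hω i) hu'
  · have h1 : ∀ i, ‖(1 - Complex.exp (-ω i * (c * u)))⁻¹‖ ≤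
        max 1 ((c * ω i).re)⁻¹ * (u⁻¹ * Real.exp u) := fun i => by
      have h2 : -ω i * (c * u) = -(c * ω i * u) := by ring
      have h3 : 0 < (c * ω i * u).re := by
        rw [Complex.re_mul_ofReal]
        exact mul_pos (hω i) hu
      rw [h2]
      refine (norm_inv_one_sub_exp_le h3).trans ?_
      rw [Complex.re_mul_ofReal, mul_inv]
      have h4 := Real.add_one_le_exp u
      have h5 : 1 + ((c * ω i).re)⁻¹ * u⁻¹ = (u + ((c * ω i).re)⁻¹) * u⁻¹ := by
        field_simp
      rw [h5, mul_comm u⁻¹, ← mul_assoc]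
      gcongr
      calc u + ((c * ω i).re)⁻¹ ≤ max 1 ((c * ω i).re)⁻¹ * u + max 1 ((c * ω i).re)⁻¹ := by
            gcongr
            · exact le_mul_of_one_le_left hu.le (le_max_left _ _)
            · exact le_max_right _ _
        _ = max 1 ((c * ω i).re)⁻¹ * (u + 1) := by ring
        _ ≤ _ := by gcongr
    rw [barnesKernel, norm_mul, norm_prod]
    have h6 : ‖Complex.exp (-a * (c * u))‖ ≤ Real.exp (‖c * a‖ * u) := by
      rw [Complex.norm_exp]
      refine Real.exp_le_exp.mpr ((Complex.re_le_norm _).trans (le_of_eq ?_))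
      rw [norm_mul, norm_mul, norm_neg, norm_mul, Complex.norm_real, Real.norm_of_nonneg hu.le]
      ring
    calc _ ≤ Real.exp (‖c * a‖ * u) * ∏ i, (max 1 ((c * ω i).re)⁻¹ * (u⁻¹ * Real.exp u)) := by
          gcongr with i
          exact h1 i
      _ = _ := by
          rw [Finset.prod_mul_distrib, Finset.prod_const, Finset.card_univ, Fintype.card_fin,
            mul_pow, ← Real.exp_nat_mul, add_mul, Real.exp_add, Real.rpow_neg hu.le,
            Real.rpow_natCast, inv_pow]
          ring

/-- The kernel minus the first `m` terms of its Laurent expansion. -/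
noncomputable def barnesRemainder (ω : Fin r → ℂ) (a : ℂ) (m : ℕ) (t : ℂ) : ℂ :=
  barnesKernel ω a t -
    ∑ n ∈ Finset.range m, PowerSeries.coeff n (bernoulliSeries ω a) * t ^ ((n : ℤ) - r)

/-- Near 0 the expansion to order r + d gives u^d after division by t^r. Away from 0 the kernel and
the Laurent terms are bounded separately. -/
theorem expPowBound_barnesRemainder (hω : ∀ i, 0 < (c * ω i).re) (hc : c ≠ 0) (a : ℂ) (d : ℕ) :
    ∃ C, ExpPowBound C d (‖c * a‖ + r) (fun u : ℝ => barnesRemainder ω a (r + d) (c * u)) := by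
  have hω0 : ∀ i, ω i ≠ 0 := fun i h => by have := hω i; rw [h] at this; simp at this
  obtain ⟨C₁, hC₁⟩ := expPowBound_barnesKernel hω a
  have hexp := hasExpansion_barnesKernel hω0 a (r + d)
  have htend : Tendsto (fun u : ℝ => c * (u : ℂ)) (𝓝[>] 0) (𝓝[≠] 0) := by
    refine tendsto_nhdsWithin_of_tendsto_nhds_of_eventually_within _ ?_ ?_
    · exact (Continuous.tendsto' (by fun_prop) 0 0 (by simp)).mono_left nhdsWithin_le_nhds
    · filter_upwards [self_mem_nhdsWithin] with u hu
      have hu' : (0 : ℝ) < u := hu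
      simp [hc, hu'.ne']
  obtain ⟨C₂, hC₂⟩ := (hexp.comp_tendsto htend).bound
  obtain ⟨u₀, hu₀, hu₀'⟩ := mem_nhdsGT_iff_exists_Ioo_subset.mp hC₂
  have hu₀ : 0 < u₀ := hu₀
  set B := ‖c * a‖ + r with hB
  have hB0 : 0 ≤ B := by positivity
  set v := u₀ / 2 with hv
  have hv0 : 0 < v := by positivity
  -- K collects the bounds for u ≥ u₀ ≥ v: every exponent is at most d, and u^(e+d) ≤ v^e u^d for e
  -- ≤ 0.
  set K := C₁ * v ^ (-(r : ℝ) - d) + ∑ n ∈ Finset.range (r + d),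
    ‖PowerSeries.coeff n (bernoulliSeries ω a)‖ * ‖c‖ ^ ((n : ℤ) - r) * v ^ ((n : ℝ) - r - d) with hK
  have hexp1 : ∀ u : ℝ, 0 < u → 1 ≤ Real.exp (B * u) := fun u hu =>
    Real.one_le_exp (by positivity)
  refine ⟨max (C₂ * ‖c‖ ^ d) K, ⟨?_, fun u hu => ?_⟩⟩
  · refine ContinuousOn.sub hC₁.cont (continuousOn_finsetSum _ fun n _ =>
      ContinuousOn.mul continuousOn_const (ContinuousOn.zpow₀ (Continuous.continuousOn
        (by fun_prop)) _ fun u hu => Or.inl ?_))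
    have hu' : (0 : ℝ) < u := hu
    simp [hc, hu'.ne']
  · rcases lt_or_ge u u₀ with hlt | hge
    · have h := hu₀' ⟨hu, hlt⟩
      have hcu : c * (u : ℂ) ≠ 0 := by simp [hc, hu.ne']
      simp only [mem_ofPred_eq, Function.comp_apply, eval_trunc] at h
      have h2 : (c * u) ^ r * barnesKernel ω a (c * u) -
          ∑ n ∈ Finset.range (r + d), PowerSeries.coeff n (bernoulliSeries ω a) * (c * u) ^ n =
          (c * u) ^ r * barnesRemainder ω a (r + d) (c * u) := by
        rw [barnesRemainder, mul_sub, Finset.mul_sum]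
        congr 1
        refine Finset.sum_congr rfl fun n _ => ?_
        rw [zpow_sub₀ hcu, zpow_natCast, zpow_natCast]
        field_simp
      rw [h2, pow_add, norm_mul, norm_mul, mul_left_comm] at h
      have h3 := le_of_mul_le_mul_left h (norm_pos_iff.mpr (pow_ne_zero r hcu))
      refine h3.trans ?_
      rw [norm_pow, norm_mul, Complex.norm_real, Real.norm_of_nonneg hu.le, mul_pow, ← mul_assoc,
        Real.rpow_natCast]
      calc C₂ * ‖c‖ ^ d * u ^ d ≤ max (C₂ * ‖c‖ ^ d) K * u ^ d := by
            gcongr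
            exact le_max_left _ _
        _ ≤ max (C₂ * ‖c‖ ^ d) K * (u ^ d * Real.exp (B * u)) := by
            have hmax : 0 ≤ max (C₂ * ‖c‖ ^ d) K := by
              have := (norm_nonneg _).trans h3
              rw [norm_pow, norm_mul, mul_pow, ← mul_assoc] at this
              refine le_max_of_le_left (nonneg_of_mul_nonneg_left this ?_)
              simp only [Complex.norm_real, Real.norm_of_nonneg hu.le]
              positivity
            refine mul_le_mul_of_nonneg_left ?_ hmax
            exact le_mul_of_one_le_right (by positivity) (hexp1 u hu)
    · have hvu : v ≤ u := by rw [hv]; linarith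
      have hC₁0 : 0 ≤ C₁ := by
        have := (norm_nonneg _).trans (hC₁.bound 1 one_pos)
        rw [Real.one_rpow, one_mul] at this
        exact nonneg_of_mul_nonneg_left this (Real.exp_pos _)
      have hpow : ∀ e : ℝ, e ≤ 0 → u ^ (e + d) ≤ v ^ e * u ^ (d : ℝ) := fun e he => by
        rw [Real.rpow_add hu]
        gcongr ?_ * _
        exact Real.rpow_le_rpow_of_nonpos hv0 hvu he
      have h1 : ‖barnesKernel ω a (c * u)‖ ≤
          C₁ * v ^ (-(r : ℝ) - d) * (u ^ (d : ℝ) * Real.exp (B * u)) := by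
        refine (hC₁.bound u hu).trans ?_
        rw [mul_assoc, ← mul_assoc (v ^ _)]
        have := hpow (-(r : ℝ) - d) (by have : (0 : ℝ) ≤ r := by positivity
                                        have : (0 : ℝ) ≤ d := by positivity
                                        linarith)
        rw [sub_add_cancel] at this
        gcongr
      have h2 : ∀ n ∈ Finset.range (r + d),
          ‖PowerSeries.coeff n (bernoulliSeries ω a) * (c * u) ^ ((n : ℤ) - r)‖ ≤
          ‖PowerSeries.coeff n (bernoulliSeries ω a)‖ * ‖c‖ ^ ((n : ℤ) - r) *
            v ^ ((n : ℝ) - r - d) * (u ^ (d : ℝ) * Real.exp (B * u)) := fun n hn => by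
        have hn' : (n : ℝ) ≤ r + d := by exact_mod_cast (Finset.mem_range.mp hn).le
        rw [norm_mul, norm_zpow, norm_mul, Complex.norm_real, Real.norm_of_nonneg hu.le, mul_zpow,
          ← mul_assoc, mul_assoc (_ * _) (v ^ _)]
        refine mul_le_mul_of_nonneg_left ?_ (by positivity)
        have := hpow ((n : ℝ) - r - d) (by linarith)
        rw [sub_add_cancel] at this
        have h5 : u ^ ((n : ℤ) - r) = u ^ ((n : ℝ) - r) := by
          rw [← Real.rpow_intCast]; push_cast; rfl
        rw [h5, ← mul_assoc]
        exact this.trans (le_mul_of_one_le_right (by positivity) (hexp1 u hu))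
      have h3 : ‖barnesRemainder ω a (r + d) (c * u)‖ ≤ K * (u ^ (d : ℝ) * Real.exp (B * u)) := by
        rw [barnesRemainder, hK, add_mul, Finset.sum_mul]
        exact (norm_sub_le _ _).trans (add_le_add h1 ((norm_sum_le _ _).trans
          (Finset.sum_le_sum h2)))
      refine h3.trans ?_
      gcongr
      exact le_max_right _ _

end BarnesMilnor

/-! ### Analytic continuation of the Barnes zeta function -/

namespace BarnesMilnor

open Filter Topology MeasureTheory Set

/-- The quotient `Γ(s + N) / Γ(s)` as a rational function of `s`. -/
noncomputable def gammaRatio : ℤ → ℂ → ℂ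
  | Int.ofNat n => fun s => ∏ i ∈ Finset.range n, (s + i)
  | Int.negSucc n => fun s => ∏ i ∈ Finset.range (n + 1), (s - (i + 1))⁻¹

theorem inv_Gamma_eq_prod_mul (s : ℂ) (n : ℕ) :
    (Complex.Gamma s)⁻¹ = (∏ i ∈ Finset.range n, (s + i)) * (Complex.Gamma (s + n))⁻¹ := by
  induction n with
  | zero => simp
  | succ n ih =>
    rw [ih, Finset.prod_range_succ, Complex.one_div_Gamma_eq_self_mul_one_div_Gamma_add_one (s + n)]
    push_cast
    ring_nf

theorem gammaRatio_eq {N : ℤ} {s : ℂ} (h : 0 < (s + N).re) :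
    (Complex.Gamma s)⁻¹ * Complex.Gamma (s + N) = gammaRatio N s := by
  have h0 := Complex.Gamma_ne_zero_of_re_pos h
  rcases N with n | n
  · simp only [Int.ofNat_eq_natCast, Int.cast_natCast] at h0
    simp only [gammaRatio, Int.ofNat_eq_natCast, Int.cast_natCast]
    rw [inv_Gamma_eq_prod_mul s n, mul_assoc, inv_mul_cancel₀ h0, mul_one]
  · have h1 := inv_Gamma_eq_prod_mul (s + (Int.negSucc n : ℤ)) (n + 1)
    have h2 : s + (Int.negSucc n : ℤ) + ((n + 1 : ℕ) : ℂ) = s := by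
      rw [Int.negSucc_eq]; push_cast; ring
    rw [h2] at h1
    rw [inv_eq_iff_eq_inv, mul_inv, inv_inv] at h1
    have h3 : (∏ i ∈ Finset.range (n + 1), (s + ((Int.negSucc n : ℤ) : ℂ) + (i : ℂ))) =
        ∏ i ∈ Finset.range (n + 1), (s - (i + 1)) := by
      rw [← Finset.prod_range_reflect]
      refine Finset.prod_congr rfl fun i hi => ?_
      have hi' : i ≤ n := by have := Finset.mem_range.mp hi; omega
      rw [Int.negSucc_eq, Nat.add_sub_cancel, Nat.cast_sub hi']
      push_cast
      ring
    have h4 : Complex.Gamma s ≠ 0 := by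
      refine Complex.Gamma_ne_zero_of_re_pos ?_
      rw [Int.negSucc_eq] at h
      have h5 : (s + ((-((n : ℤ) + 1) : ℤ) : ℂ)).re = s.re - (n + 1) := by simp; ring
      rw [h5] at h
      linarith
    rw [h1, h3, mul_comm, mul_assoc, mul_inv_cancel₀ h4, mul_one, ← Finset.prod_inv_distrib]
    rfl

/-- For N < 0 the denominators are s - 1, …, s - |N|, and |N| ≤ r. -/
theorem differentiableAt_gammaRatio {N : ℤ} {r : ℕ} (hN : -(r : ℤ) ≤ N) {s : ℂ}
    (hs : ∀ j : ℕ, 1 ≤ j → j ≤ r → s ≠ (j : ℂ)) : DifferentiableAt ℂ (gammaRatio N) s := by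
  rcases N with n | n
  · simp only [gammaRatio]
    fun_prop
  · simp only [gammaRatio]
    refine DifferentiableAt.fun_finsetProd fun i hi => DifferentiableAt.inv (by fun_prop) ?_
    have h := hs (i + 1) (by omega) (by have := Finset.mem_range.mp hi; omega)
    rw [sub_ne_zero]
    exact_mod_cast h

/-- Both arguments are below π/2 in absolute value, so their sum stays on the principal branch. -/
theorem mul_cpow_of_re_pos {c z : ℂ} (hc : 0 < c.re) (hz : 0 < z.re) (s : ℂ) :
    (c * z) ^ s = c ^ s * z ^ s := by
  have hc0 : c ≠ 0 := fun h => by simp [h] at hc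
  have hz0 : z ≠ 0 := fun h => by simp [h] at hz
  have h1 := abs_lt.mp (Complex.abs_arg_lt_pi_div_two_iff.mpr (Or.inl hc))
  have h2 := abs_lt.mp (Complex.abs_arg_lt_pi_div_two_iff.mpr (Or.inl hz))
  rw [Complex.cpow_def_of_ne_zero (mul_ne_zero hc0 hz0), Complex.cpow_def_of_ne_zero hc0,
    Complex.cpow_def_of_ne_zero hz0, Complex.log_mul hc0 hz0, add_mul, Complex.exp_add]
  constructor <;> linarith [h1.1, h1.2, h2.1, h2.2]

/-- The contribution of one Laurent term. The powers of c cancel, so it does not depend on the ray.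
-/
theorem mellin_exp_mul_zpow {c w s : ℂ} (hc : 0 < c.re) (hw : 0 < w.re) (hcw : 0 < (c * w).re)
    {N : ℤ} (hs : 0 < (s + N).re) :
    MellinConvergent (fun u : ℝ => Complex.exp (-(c * w * u)) * (c * u) ^ N) s ∧
    c ^ s * mellin (fun u : ℝ => Complex.exp (-(c * w * u)) * (c * u) ^ N) s =
      w ^ (-(s + N)) * Complex.Gamma (s + N) := by
  have hc0 : c ≠ 0 := fun h => by simp [h] at hc
  have hfun : ∀ u ∈ Ioi (0 : ℝ), c ^ N * (Complex.exp (-(c * w * u)) * (u : ℂ) ^ (s + N - 1)) =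
      (u : ℂ) ^ (s - 1) • (Complex.exp (-(c * w * u)) * (c * u) ^ N) := fun u hu => by
    have hu' : (0 : ℝ) < u := hu
    have hu0 : (u : ℂ) ≠ 0 := by exact_mod_cast hu'.ne'
    have : s + N - 1 = (s - 1) + N := by ring
    rw [this, Complex.cpow_add _ _ hu0, Complex.cpow_intCast, mul_zpow, smul_eq_mul]
    ring
  refine ⟨IntegrableOn.congr_fun (Integrable.const_mul (integrableOn_cpow_mul_exp hs hcw) (c ^ N))
    hfun measurableSet_Ioi, ?_⟩
  rw [mellin, ← setIntegral_congr_fun measurableSet_Ioi hfun, integral_const_mul,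
    integral_exp_mul_cpow hs hcw, mul_cpow_of_re_pos hc hw]
  have h1 : c ^ s * c ^ N * c ^ (-(s + N)) = 1 := by
    rw [← Complex.cpow_intCast, ← Complex.cpow_add _ _ hc0, ← Complex.cpow_add _ _ hc0,
      add_neg_cancel, Complex.cpow_zero]
  calc _ = (c ^ s * c ^ N * c ^ (-(s + N))) * (w ^ (-(s + N)) * Complex.Gamma (s + N)) := by ring
    _ = _ := by rw [h1, one_mul]

/-- Induction on r by splitting off the first index. The field is general because the result is used
both for the complex terms and for their norms. -/
theorem hasSum_prod_geometric {K : Type*} [NormedField K] [CompleteSpace K] {r : ℕ} {x : Fin r → K}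
    (hx : ∀ i, ‖x i‖ < 1) :
    Summable (fun n : Fin r → ℕ => ‖∏ i, x i ^ n i‖) ∧
      HasSum (fun n : Fin r → ℕ => ∏ i, x i ^ n i) (∏ i, (1 - x i)⁻¹) := by
  induction r with
  | zero =>
    simp only [Finset.univ_eq_empty, Finset.prod_empty]
    exact ⟨(hasSum_fintype _).summable, by simp⟩
  | succ r ih =>
    obtain ⟨h1, h2⟩ := ih fun i => hx i.succ
    have h3 := summable_norm_geometric_of_norm_lt_one (hx 0)
    have h4 := hasSum_geometric_of_norm_lt_one (hx 0)
    have h6 : Summable (fun p : ℕ × (Fin r → ℕ) => ‖x 0 ^ p.1 * ∏ i, x i.succ ^ p.2 i‖) :=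
      Summable.mul_norm (f := fun n : ℕ => x 0 ^ n)
        (g := fun n : Fin r → ℕ => ∏ i, x i.succ ^ n i) h3 h1
    have h5 : HasSum (fun p : ℕ × (Fin r → ℕ) => x 0 ^ p.1 * ∏ i, x i.succ ^ p.2 i)
        ((1 - x 0)⁻¹ * ∏ i : Fin r, (1 - x i.succ)⁻¹) :=
      HasSum.mul (f := fun n : ℕ => x 0 ^ n)
        (g := fun n : Fin r → ℕ => ∏ i, x i.succ ^ n i) h4 h2 h6.of_norm
    rw [← (Fin.consEquiv fun _ : Fin (r + 1) => ℕ).hasSum_iff,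
      ← (Fin.consEquiv fun _ : Fin (r + 1) => ℕ).summable_iff]
    have key : ∀ p : ℕ × (Fin r → ℕ),
        ∏ i, x i ^ (Fin.consEquiv (fun _ : Fin (r + 1) => ℕ)) p i =
        x 0 ^ p.1 * ∏ i, x i.succ ^ p.2 i := fun p => by
      rw [Fin.prod_univ_succ]; rfl
    simp only [Function.comp_def, key]
    rw [Fin.prod_univ_succ]
    exact ⟨h6, h5⟩

variable {r : ℕ} {ω : Fin r → ℂ} {a c w : ℂ}

/-- The kernel integral, along the ray through `c`, of the Laurent remainder. -/
noncomputable def barnesIntegral (ω : Fin r → ℂ) (a c : ℂ) (m : ℕ) (w s : ℂ) : ℂ :=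
  mellin (fun u : ℝ => Complex.exp (-(c * w * u)) * barnesRemainder ω a m (c * u)) s

/-- The continuation of `ζ_r(s, w + a; ω)`, for `Re s > r - m`. -/
noncomputable def barnesContinuation (ω : Fin r → ℂ) (a c : ℂ) (m : ℕ) (w s : ℂ) : ℂ :=
  ∑ n ∈ Finset.range m, PowerSeries.coeff n (bernoulliSeries ω a) *
      (gammaRatio ((n : ℤ) - r) s * w ^ (-(s + ((n : ℤ) - r : ℤ)))) +
    c ^ s * (Complex.Gamma s)⁻¹ * barnesIntegral ω a c m w s

/-- The term newly subtracted under the integral is exactly the one added to the explicit sum, so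
the number of removed terms is immaterial wherever both integrals converge. -/
theorem barnesContinuation_succ (hc : 0 < c.re) (hw : 0 < w.re) (hcw : 0 < (c * w).re) {m : ℕ}
    {s : ℂ} (hs : 0 < (s + ((m : ℤ) - r : ℤ)).re)
    (hm : MellinConvergent
      (fun u : ℝ => Complex.exp (-(c * w * u)) * barnesRemainder ω a m (c * u)) s) :
    MellinConvergent
      (fun u : ℝ => Complex.exp (-(c * w * u)) * barnesRemainder ω a (m + 1) (c * u)) s ∧
    barnesContinuation ω a c (m + 1) w s = barnesContinuation ω a c m w s := by
  obtain ⟨h1, h2⟩ := mellin_exp_mul_zpow hc hw hcw hs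
  set p := PowerSeries.coeff m (bernoulliSeries ω a)
  have h3 := hasMellin_const_smul h1 p
  have h4 := hasMellin_sub hm h3.1
  have hfun : (fun u : ℝ => Complex.exp (-(c * w * u)) * barnesRemainder ω a (m + 1) (c * u)) =
      fun u : ℝ => Complex.exp (-(c * w * u)) * barnesRemainder ω a m (c * u) -
        p • (Complex.exp (-(c * w * u)) * (c * u) ^ ((m : ℤ) - r)) := by
    funext u
    simp only [barnesRemainder, Finset.sum_range_succ, smul_eq_mul]
    ring
  refine ⟨hfun ▸ h4.1, ?_⟩
  rw [barnesContinuation, barnesContinuation, barnesIntegral, hfun, h4.2, h3.2,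
    Finset.sum_range_succ, barnesIntegral, ← gammaRatio_eq hs]
  linear_combination (-(p * (Complex.Gamma s)⁻¹)) * h2

/-- `c` is an admissible direction for the ray of integration, and `w` is large in it. -/
structure Admissible (ω : Fin r → ℂ) (a c w : ℂ) : Prop where
  c_re : 0 < c.re
  w_re : 0 < w.re
  ω_re : ∀ i, 0 < (ω i).re
  cω_re : ∀ i, 0 < (c * ω i).re
  a_re : 0 ≤ a.re
  lt : ‖c * a‖ + r < (c * w).re

namespace Admissible

theorem cw_re (h : Admissible ω a c w) : 0 < (c * w).re :=
  lt_of_le_of_lt (by positivity) h.lt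

theorem c_ne (h : Admissible ω a c w) : c ≠ 0 := fun h0 => by
  have := h.c_re
  simp [h0] at this

theorem mellinConvergent (h : Admissible ω a c w) (d : ℕ) {s : ℂ} (hs : -(d : ℝ) < s.re) :
    MellinConvergent
      (fun u : ℝ => Complex.exp (-(c * w * u)) * barnesRemainder ω a (r + d) (c * u)) s := by
  obtain ⟨C, hC⟩ := expPowBound_barnesRemainder h.cω_re h.c_ne a d
  exact (hC.mellinClass h.lt).mellinConvergent hs

theorem barnesContinuation_add (h : Admissible ω a c w) (d e : ℕ) {s : ℂ} (hs : -(d : ℝ) < s.re) :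
    barnesContinuation ω a c (r + (d + e)) w s = barnesContinuation ω a c (r + d) w s := by
  induction e with
  | zero => rfl
  | succ e ih =>
    have hs' : -((d + e : ℕ) : ℝ) < s.re := by
      push_cast; have : (0 : ℝ) ≤ e := by positivity
      linarith
    rw [← ih]
    refine (barnesContinuation_succ h.c_re h.w_re h.cw_re ?_ (h.mellinConvergent (d + e) hs')).2
    push_cast at hs' ⊢
    simp
    linarith

theorem barnesContinuation_eq_mellin (h : Admissible ω a c w) (m : ℕ) {s : ℂ}
    (hs : (r : ℝ) < s.re) :
    barnesContinuation ω a c m w s = c ^ s * (Complex.Gamma s)⁻¹ *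
      mellin (fun u : ℝ => Complex.exp (-(c * w * u)) * barnesKernel ω a (c * u)) s := by
  suffices H : MellinConvergent
      (fun u : ℝ => Complex.exp (-(c * w * u)) * barnesRemainder ω a m (c * u)) s ∧
      barnesContinuation ω a c m w s = c ^ s * (Complex.Gamma s)⁻¹ *
      mellin (fun u : ℝ => Complex.exp (-(c * w * u)) * barnesKernel ω a (c * u)) s from H.2
  induction m with
  | zero =>
    obtain ⟨C, hC⟩ := expPowBound_barnesKernel h.cω_re a
    have h1 := (hC.mellinClass h.lt).mellinConvergent (s := s) (by rwa [neg_neg])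
    simp only [barnesContinuation, barnesIntegral, barnesRemainder, Finset.range_zero,
      Finset.sum_empty, sub_zero, zero_add, and_true]
    exact h1
  | succ m ih =>
    have h1 := barnesContinuation_succ h.c_re h.w_re h.cw_re ?_ ih.1
    · exact ⟨h1.1, h1.2.trans ih.2⟩
    · simp
      have : (0 : ℝ) ≤ m := by positivity
      linarith

theorem differentiableAt_barnesContinuation (h : Admissible ω a c w) (d : ℕ) {s : ℂ}
    (hs : -(d : ℝ) < s.re) (hs' : ∀ j : ℕ, 1 ≤ j → j ≤ r → s ≠ (j : ℂ)) :
    DifferentiableAt ℂ (barnesContinuation ω a c (r + d) w) s := by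
  obtain ⟨C, hC⟩ := expPowBound_barnesRemainder h.cω_re h.c_ne a d
  have hI : DifferentiableAt ℂ (barnesIntegral ω a c (r + d) w) s :=
    ((hC.mellinClass h.lt).hasDerivAt_mellin hs).differentiableAt
  have hw0 : w ≠ 0 := fun h0 => by have := h.w_re; simp [h0] at this
  refine DifferentiableAt.add (DifferentiableAt.fun_sum fun n _ => DifferentiableAt.const_mul
    ((differentiableAt_gammaRatio (by omega) hs').mul
      (DifferentiableAt.const_cpow (by fun_prop) (Or.inl hw0))) _)
    (((DifferentiableAt.const_cpow (by fun_prop) (Or.inl h.c_ne)).mul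
      (Complex.differentiable_one_div_Gamma s)).mul hI)

/-- The kernel is expanded in a multiple geometric series and integrated term by term; each term is
an Euler integral, and the factor c^s undoes the rotation of the ray. -/
theorem hasSum_mellin (h : Admissible ω a c w) {s : ℂ} (hs : (r : ℝ) < s.re) :
    HasSum (fun n : Fin r → ℕ => ((∑ i, (n i : ℂ) * ω i) + (w + a)) ^ (-s))
      (c ^ s * (Complex.Gamma s)⁻¹ *
        mellin (fun u : ℝ => Complex.exp (-(c * w * u)) * barnesKernel ω a (c * u)) s) := by
  have hs0 : 0 < s.re := lt_of_le_of_lt (by positivity) hs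
  have hz : ∀ n : Fin r → ℕ, 0 < ((∑ i, (n i : ℂ) * ω i) + (w + a)).re := fun n => by
    rw [Complex.add_re, Complex.add_re, Complex.re_sum]
    have h1 : 0 ≤ ∑ i, ((n i : ℂ) * ω i).re := Finset.sum_nonneg fun i _ => by
      rw [← Complex.ofReal_natCast, Complex.re_ofReal_mul]
      exact mul_nonneg (by positivity) (h.ω_re i).le
    have := h.w_re
    have := h.a_re
    linarith
  have hca : -‖c * a‖ ≤ (c * a).re := (abs_le.mp (Complex.abs_re_le_norm _)).1
  have hcwa : (r : ℝ) < (c * (w + a)).re := by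
    rw [mul_add, Complex.add_re]
    have := h.lt
    linarith
  have hcz : ∀ n : Fin r → ℕ, 0 < (c * ((∑ i, (n i : ℂ) * ω i) + (w + a))).re := fun n => by
    rw [mul_add, Complex.add_re, Finset.mul_sum, Complex.re_sum]
    have h1 : 0 ≤ ∑ i, (c * ((n i : ℂ) * ω i)).re := Finset.sum_nonneg fun i _ => by
      rw [mul_left_comm, ← Complex.ofReal_natCast, Complex.re_ofReal_mul]
      exact mul_nonneg (by positivity) (h.cω_re i).le
    have : (0 : ℝ) ≤ r := by positivity
    linarith
  have hx : ∀ u : ℝ, 0 < u → ∀ i, ‖Complex.exp (-(c * ω i * u))‖ < 1 := fun u hu i => by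
    rw [Complex.norm_exp, Real.exp_lt_one_iff, Complex.neg_re, Complex.re_mul_ofReal]
    have := mul_pos (h.cω_re i) hu
    linarith
  have hF : ∀ (n : Fin r → ℕ) (u : ℝ),
      Complex.exp (-(c * ((∑ i, (n i : ℂ) * ω i) + (w + a)) * u)) =
      Complex.exp (-(c * (w + a) * u)) * ∏ i, Complex.exp (-(c * ω i * u)) ^ n i := fun n u => by
    simp only [← Complex.exp_nat_mul]
    rw [← Complex.exp_sum, ← Complex.exp_add]
    congr 1
    rw [mul_add, Finset.mul_sum, add_mul, Finset.sum_mul, neg_add_rev]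
    congr 1
    rw [← Finset.sum_neg_distrib]
    exact Finset.sum_congr rfl fun i _ => by ring
  have key : HasSum (fun n : Fin r → ℕ => ∫ u in Ioi (0 : ℝ),
      Complex.exp (-(c * ((∑ i, (n i : ℂ) * ω i) + (w + a)) * u)) * (u : ℂ) ^ (s - 1))
      (mellin (fun u : ℝ => Complex.exp (-(c * w * u)) * barnesKernel ω a (c * u)) s) := by
    refine hasSum_integral_of_dominated_convergence
      (fun n u => ‖(u : ℂ) ^ (s - 1) * Complex.exp (-(c * (w + a) * u))‖ *
        ∏ i, ‖Complex.exp (-(c * ω i * u))‖ ^ n i) ?_ ?_ ?_ ?_ ?_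
    · exact fun n => (integrableOn_cpow_mul_exp hs0 (hcz n)).aestronglyMeasurable
    · refine fun n => Eventually.of_forall fun u => le_of_eq ?_
      rw [hF, norm_mul, norm_mul, norm_mul, norm_prod]
      simp only [norm_pow]
      ring
    · refine (ae_restrict_mem measurableSet_Ioi).mono fun u hu => Summable.mul_left _ ?_
      exact (hasSum_prod_geometric fun i => by rw [norm_norm]; exact hx u hu i).2.summable
    -- The sum of the norms is again a Barnes kernel, with real parameters Re(c ω_i), so the kernel
    -- bound makes the dominating series integrable for Re s > r.
    · let b : Fin r → ℂ := fun i => ((c * ω i).re : ℂ)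
      have hb : ∀ i, 0 < (1 * b i).re := fun i => by simpa [b] using h.cω_re i
      obtain ⟨C, hC⟩ := expPowBound_barnesKernel hb 0
      have h1 := (hC.mellinClass (z := ((c * (w + a)).re : ℂ))
        (by rw [mul_zero, norm_zero, zero_add, Complex.ofReal_re]; exact hcwa)).mellinConvergent
          (s := s) (by rwa [neg_neg])
      refine (Integrable.norm h1).congr ((ae_restrict_mem measurableSet_Ioi).mono fun u hu => ?_)
      have hu' : (0 : ℝ) < u := hu
      have h3 := (hasSum_prod_geometric (x := fun i => ‖Complex.exp (-(c * ω i * u))‖)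
        fun i => by rw [norm_norm]; exact hx u hu i).2
      have h4 : ∀ i, ‖(1 - Complex.exp (-b i * (1 * u)))⁻¹‖ =
          (1 - ‖Complex.exp (-(c * ω i * u))‖)⁻¹ := fun i => by
        have h5 : (1 - Complex.exp (-b i * (1 * u))) =
            ((1 - ‖Complex.exp (-(c * ω i * u))‖ : ℝ) : ℂ) := by
          rw [Complex.norm_exp, Complex.neg_re, Complex.re_mul_ofReal, Complex.ofReal_sub,
            Complex.ofReal_exp, Complex.ofReal_neg, Complex.ofReal_mul, one_mul, neg_mul,
            Complex.ofReal_one]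
        rw [h5, norm_inv, Complex.norm_real, Real.norm_of_nonneg (by linarith [hx u hu i])]
      simp only
      rw [tsum_mul_left, h3.tsum_eq, smul_eq_mul, norm_mul, norm_mul, norm_mul, barnesKernel,
        norm_mul, norm_prod, Finset.prod_congr rfl fun i _ => h4 i, neg_zero, zero_mul,
        Complex.exp_zero, norm_one, one_mul, mul_assoc]
      congr 2
      rw [Complex.norm_exp, Complex.norm_exp, Complex.neg_re, Complex.neg_re,
        Complex.re_mul_ofReal, Complex.re_mul_ofReal, Complex.ofReal_re]
    · refine (ae_restrict_mem measurableSet_Ioi).mono fun u hu => ?_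
      have h1 := (hasSum_prod_geometric (x := fun i => Complex.exp (-(c * ω i * u))) (hx u hu)).2
      have h2 := h1.mul_left (Complex.exp (-(c * (w + a) * u)) * (u : ℂ) ^ (s - 1))
      have h3 : (u : ℂ) ^ (s - 1) • (Complex.exp (-(c * w * u)) * barnesKernel ω a (c * u)) =
          Complex.exp (-(c * (w + a) * u)) * (u : ℂ) ^ (s - 1) *
            ∏ i, (1 - Complex.exp (-(c * ω i * u)))⁻¹ := by
        have h4 : Complex.exp (-(c * (w + a) * u)) =
            Complex.exp (-(c * w * u)) * Complex.exp (-a * (c * u)) := by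
          rw [← Complex.exp_add]; ring_nf
        have h5 : ∀ i, -ω i * (c * u) = -(c * ω i * u) := fun i => by ring
        simp only [barnesKernel, h4, h5, smul_eq_mul]
        ring
      rw [h3]
      refine h2.congr_fun fun n => ?_
      rw [hF]
      ring
  refine (key.mul_left (c ^ s * (Complex.Gamma s)⁻¹)).congr_fun fun n => ?_
  have h1 : c ^ s * c ^ (-s) = 1 := by
    rw [← Complex.cpow_add _ _ h.c_ne, add_neg_cancel, Complex.cpow_zero]
  have h2 := Complex.Gamma_ne_zero_of_re_pos hs0
  rw [integral_exp_mul_cpow hs0 (hcz n), mul_cpow_of_re_pos h.c_re (hz n)]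
  field_simp
  linear_combination (-((∑ i, (n i : ℂ) * ω i) + (w + a)) ^ (-s)) * h1

theorem exists_isBarnesZeta (h : Admissible ω a c w) :
    ∃ F, IsBarnesZeta ω (w + a) F ∧
      ∀ (d : ℕ) (s : ℂ), -(d : ℝ) < s.re → F s = barnesContinuation ω a c (r + d) w s := by
  -- The number of removed terms grows with |Re s| so that every s is reached. Near a given point F
  -- agrees with a continuation of fixed order, which yields holomorphy.
  set F : ℂ → ℂ := fun s => barnesContinuation ω a c (r + (⌈|s.re|⌉₊ + 1)) w s with hF
  have hFd : ∀ (d : ℕ) (s : ℂ), -(d : ℝ) < s.re → F s = barnesContinuation ω a c (r + d) w s := by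
    intro d s hs
    have h1 : -((⌈|s.re|⌉₊ + 1 : ℕ) : ℝ) < s.re := by
      have := Nat.le_ceil |s.re|
      have := neg_abs_le s.re
      push_cast
      linarith
    rw [hF]
    simp only
    rw [← h.barnesContinuation_add d (⌈|s.re|⌉₊ + 1) hs, ← h.barnesContinuation_add _ d h1,
      add_comm d]
  refine ⟨F, ⟨fun s hs => ?_, fun s hs => ?_⟩, hFd⟩
  · obtain ⟨d, hd⟩ := exists_nat_gt (-s.re)
    have hd' : -(d : ℝ) < s.re := by linarith
    refine DifferentiableAt.differentiableWithinAt ?_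
    refine (h.differentiableAt_barnesContinuation d hd' hs).congr_of_eventuallyEq ?_
    filter_upwards [(isOpen_lt continuous_const Complex.continuous_re).mem_nhds hd'] with z hz
    exact hFd d z hz
  · rw [hFd 0 s (lt_of_le_of_lt (by simp) hs), h.barnesContinuation_eq_mellin _ hs]
    exact h.hasSum_mellin hs

theorem barnesZeta_eq (h : Admissible ω a c w) (d : ℕ) {s : ℂ} (hs : -(d : ℝ) < s.re)
    (hs' : ∀ j : ℕ, 1 ≤ j → j ≤ r → s ≠ (j : ℂ)) :
    barnesZeta ω (w + a) s = barnesContinuation ω a c (r + d) w s := by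
  obtain ⟨F, hF, hFd⟩ := h.exists_isBarnesZeta
  have hex : ∃ F : ℂ → ℂ, IsBarnesZeta ω (w + a) F := ⟨F, hF⟩
  rw [← hFd d s hs, barnesZeta, dif_pos hex]
  exact hex.choose_spec.eq hF hs'

end Admissible

end BarnesMilnor

/-! ### Harmonic sums, the balancing factor and the model functions -/

namespace BarnesMilnor

open Filter Topology MeasureTheory Set

open Classical in
theorem multipleHarmonic_eq_sum_piFinset (k μ : ℕ) :
    multipleHarmonic k μ =
      ∑ j ∈ (Fintype.piFinset fun _ : Fin μ => Finset.Icc 1 k) with Monotone j,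
        ∏ i, ((j i : ℕ) : ℂ)⁻¹ := by
  rw [multipleHarmonic]
  refine Finset.sum_bij' (fun j _ i => (j i : ℕ))
    (fun j hj i => ⟨j i, Fintype.mem_piFinset.mp (Finset.mem_filter.mp hj).1 i⟩) ?_ ?_ ?_ ?_ ?_
  · intro j hj
    simp only [Finset.mem_filter, Fintype.mem_piFinset]
    exact ⟨fun i => (j i).2, fun x y hxy => (Finset.mem_filter.mp hj).2 hxy⟩
  · intro j hj
    simp only [Finset.mem_filter, Finset.mem_univ, true_and]
    exact fun x y hxy => (Finset.mem_filter.mp hj).2 hxy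
  · intros; rfl
  · intros; rfl
  · intros; rfl

theorem multipleHarmonic_zero_right (k : ℕ) : multipleHarmonic k 0 = 1 := by
  classical
  rw [multipleHarmonic_eq_sum_piFinset, Finset.filter_true_of_mem]
  · simp
  · exact fun j _ => Subsingleton.monotone j

theorem multipleHarmonic_zero_succ (μ : ℕ) : multipleHarmonic 0 (μ + 1) = 0 := by
  classical
  rw [multipleHarmonic_eq_sum_piFinset]
  refine Finset.sum_eq_zero fun j hj => ?_
  have := Fintype.mem_piFinset.mp (Finset.mem_filter.mp hj).1 0
  simp at this

/-- Split according to whether the largest index equals k + 1; if it does, remove it. -/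
theorem multipleHarmonic_succ_succ (k μ : ℕ) :
    multipleHarmonic (k + 1) (μ + 1) =
      multipleHarmonic k (μ + 1) + multipleHarmonic (k + 1) μ * ((k + 1 : ℕ) : ℂ)⁻¹ := by
  classical
  simp only [multipleHarmonic_eq_sum_piFinset]
  rw [← Finset.sum_filter_add_sum_filter_not _ (fun j : Fin (μ + 1) → ℕ => j (Fin.last μ) = k + 1),
    add_comm]
  congr 1
  · refine Finset.sum_congr ?_ fun _ _ => rfl
    ext j
    simp only [Finset.mem_filter, Fintype.mem_piFinset, Finset.mem_Icc]
    constructor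
    · rintro ⟨⟨h1, h2⟩, h3⟩
      refine ⟨fun i => ⟨(h1 i).1, ?_⟩, h2⟩
      have := h2 (Fin.le_last i)
      have := (h1 (Fin.last μ)).2
      omega
    · rintro ⟨h1, h2⟩
      exact ⟨⟨fun i => ⟨(h1 i).1, (h1 i).2.trans (Nat.le_succ k)⟩, h2⟩,
        by have := (h1 (Fin.last μ)).2; omega⟩
  · rw [Finset.sum_mul]
    refine Finset.sum_bij' (fun j _ => Fin.init j)
      (fun j _ => (Fin.snoc j (k + 1) : Fin (μ + 1) → ℕ)) ?_ ?_ ?_ ?_ ?_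
    · intro j hj
      simp only [Finset.mem_filter, Fintype.mem_piFinset] at hj ⊢
      exact ⟨fun i => hj.1.1 _, fun x y hxy => hj.1.2 (Fin.castSucc_le_castSucc_iff.mpr hxy)⟩
    · intro j hj
      simp only [Finset.mem_filter, Fintype.mem_piFinset, Finset.mem_Icc] at hj ⊢
      refine ⟨⟨fun i => ?_, ?_⟩, by simp⟩
      · induction i using Fin.lastCases with
        | last => simp
        | cast i => simpa using hj.1 i
      · intro x y hxy
        induction y using Fin.lastCases with
        | last =>
          induction x using Fin.lastCases with
          | last => exact le_rfl
          | cast x => simpa using (hj.1 x).2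
        | cast y =>
          induction x using Fin.lastCases with
          | last => exact absurd hxy (not_le.mpr (Fin.castSucc_lt_last y))
          | cast x => simpa using hj.2 (Fin.castSucc_le_castSucc_iff.mp hxy)
    · intro j hj
      rw [← (Finset.mem_filter.mp hj).2]
      exact Fin.snoc_init_self j
    · intro j hj
      exact Fin.init_snoc _ _
    · intro j hj
      rw [Fin.prod_univ_castSucc, (Finset.mem_filter.mp hj).2]
      rfl

/-- The balancing factor `Γ(x - k) / Γ(x) = 1 / ((x - 1) ⋯ (x - k))`. -/
noncomputable def balancingFactor (k : ℕ) (x : ℂ) : ℂ := ∏ i ∈ Finset.range k, (x - (i + 1))⁻¹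

theorem analyticAt_balancingFactor (k : ℕ) {x : ℂ} (hx : x.re < 1) :
    AnalyticAt ℂ (balancingFactor k) x := by
  refine Finset.analyticAt_fun_prod _ fun i _ => AnalyticAt.inv (by fun_prop) ?_
  intro h
  have h1 := congrArg Complex.re h
  simp at h1
  have : (0 : ℝ) ≤ i := by positivity
  linarith

theorem balancingFactor_succ (k : ℕ) {x : ℂ} (hx : x.re < 1) :
    balancingFactor k x = (x - (k + 1)) * balancingFactor (k + 1) x := by
  have h : x - (k + 1) ≠ 0 := by
    intro h
    have h1 := congrArg Complex.re h
    simp at h1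
    have : (0 : ℝ) ≤ k := by positivity
    linarith
  rw [balancingFactor, balancingFactor, Finset.prod_range_succ]
  field_simp

theorem iteratedDeriv_sub_const_mul {f : ℂ → ℂ} {x : ℂ} (hf : AnalyticAt ℂ f x) (b : ℂ) (n : ℕ) :
    iteratedDeriv (n + 1) (fun z => (z - b) * f z) x =
      (x - b) * iteratedDeriv (n + 1) f x + (n + 1) * iteratedDeriv n f x := by
  have h2 : ∀ i, iteratedDeriv (i + 2) (fun z : ℂ => z - b) x = 0 := fun i => by
    rw [iteratedDeriv_succ', iteratedDeriv_succ']
    simp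
  rw [iteratedDeriv_fun_mul (by fun_prop) hf.contDiffAt, Finset.sum_range_succ',
    Finset.sum_range_succ', Finset.sum_eq_zero]
  · simp [iteratedDeriv_succ' (n := 0)]
    ring
  · intro i _
    rw [h2]
    ring

theorem iteratedDeriv_balancingFactor_succ_succ (k n : ℕ) :
    iteratedDeriv (n + 1) (balancingFactor k) 0 =
      -(k + 1) * iteratedDeriv (n + 1) (balancingFactor (k + 1)) 0 +
        (n + 1) * iteratedDeriv n (balancingFactor (k + 1)) 0 := by
  have h : balancingFactor k =ᶠ[𝓝 0] fun x => (x - (k + 1)) * balancingFactor (k + 1) x := by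
    filter_upwards [(isOpen_lt Complex.continuous_re continuous_const).mem_nhds
      (show (0 : ℂ).re < 1 by simp)] with x hx
    exact balancingFactor_succ k hx
  rw [h.iteratedDeriv_eq, iteratedDeriv_sub_const_mul (analyticAt_balancingFactor _ (by simp)),
    zero_sub]

/-- The product of 1/(x-i) for i ≤ k is (-1)^k/k! times the product of 1/(1 - x/i), whose Taylor
coefficients are the complete homogeneous sums H_k(n). The induction compares the recursions in k
and n on both sides. -/
theorem iteratedDeriv_balancingFactor (k n : ℕ) :
    iteratedDeriv n (balancingFactor k) 0 =
      (n.factorial : ℂ) * ((-1) ^ k / (k.factorial : ℂ)) * multipleHarmonic k n := by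
  induction k generalizing n with
  | zero =>
    have h : balancingFactor 0 = fun _ => 1 := by ext x; simp [balancingFactor]
    rw [h]
    rcases n with _ | n
    · simp [multipleHarmonic_zero_right]
    · rw [multipleHarmonic_zero_succ, iteratedDeriv_succ']
      simp
  | succ k ih =>
    have hk : ((k : ℂ) + 1) ≠ 0 := by exact_mod_cast Nat.succ_ne_zero k
    have hk' : (k.factorial : ℂ) ≠ 0 := by exact_mod_cast k.factorial_ne_zero
    induction n with
    | zero =>
      have h1 := ih 0
      simp only [iteratedDeriv_zero, multipleHarmonic_zero_right] at h1 ⊢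
      rw [balancingFactor_succ k (by simp)] at h1
      rw [Nat.factorial_succ k, pow_succ]
      push_cast
      field_simp at h1 ⊢
      linear_combination (-1) * h1
    | succ n ihn =>
      have h1 := iteratedDeriv_balancingFactor_succ_succ k n
      rw [ih, ihn] at h1
      rw [multipleHarmonic_succ_succ]
      rw [Nat.factorial_succ k, Nat.factorial_succ n, pow_succ] at *
      push_cast at *
      field_simp at h1 ⊢
      linear_combination h1

/-- Leibniz rule: the binomial coefficient times the (m-μ)-th derivative of the balancing factor is
the coefficient c^m_{m-μ,k}. -/
theorem balancedHyperGamma_natCast (m : ℕ) {r : ℕ} (ω : Fin r → ℂ) (k : ℕ) (w : ℂ)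
    (hζ : AnalyticAt ℂ (barnesZeta ω w) (-(k : ℂ))) :
    balancedHyperGamma m ω (k : ℤ) w =
      iteratedDeriv m (fun x => barnesZeta ω w (x - k) * balancingFactor k x) 0 := by
  have h1 : AnalyticAt ℂ (fun x : ℂ => barnesZeta ω w (x - k)) 0 := by
    refine AnalyticAt.fun_comp (g := barnesZeta ω w) (f := fun x : ℂ => x - k) ?_ (by fun_prop)
    simpa using hζ
  rw [iteratedDeriv_fun_mul h1.contDiffAt (analyticAt_balancingFactor k (by simp)).contDiffAt]
  change ∑ μ ∈ Finset.range (m + 1), balancingCoeff m (m - μ) k * logHyperGamma μ ω k w = _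
  refine Finset.sum_congr rfl fun i hi => ?_
  have hi' : i ≤ m := by have := Finset.mem_range.mp hi; omega
  have h2 : iteratedDeriv i (fun x => barnesZeta ω w (x - k)) 0 =
      iteratedDeriv i (barnesZeta ω w) (-k) := by
    rw [iteratedDeriv_comp_sub_const]
    simp only [zero_sub]
  rw [h2, iteratedDeriv_balancingFactor, logHyperGamma, balancingCoeff, Nat.sub_sub_self hi',
    Nat.choose_eq_factorial_div_factorial hi', Nat.cast_div (Nat.factorial_mul_factorial_dvd_factorial hi')
      (by exact_mod_cast (mul_ne_zero i.factorial_ne_zero (m - i).factorial_ne_zero))]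
  have h3 : (i.factorial : ℂ) ≠ 0 := by exact_mod_cast i.factorial_ne_zero
  have h4 : ((m - i).factorial : ℂ) ≠ 0 := by exact_mod_cast (m - i).factorial_ne_zero
  push_cast
  field_simp

/-- The model function `∂_x^m (Γ(x - q) / Γ(x) w ^ (q - x))` at `x = 0`. -/
noncomputable def logPower (m q : ℕ) (w : ℂ) : ℂ :=
  w ^ q * ∑ i ∈ Finset.range (m + 1), (m.choose i : ℂ) * (-Complex.log w) ^ i *
    iteratedDeriv (m - i) (balancingFactor q) 0

theorem iteratedDeriv_cpow_mul_balancingFactor (m q : ℕ) {w : ℂ} (hw : w ≠ 0) :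
    iteratedDeriv m (fun x => w ^ ((q : ℂ) - x) * balancingFactor q x) 0 = logPower m q w := by
  have h1 : ∀ x : ℂ, w ^ ((q : ℂ) - x) = w ^ q * Complex.exp (-Complex.log w * x) := fun x => by
    rw [sub_eq_add_neg, Complex.cpow_add _ _ hw, Complex.cpow_natCast,
      Complex.cpow_def_of_ne_zero hw]
    ring_nf
  simp only [h1, mul_assoc]
  rw [iteratedDeriv_const_mul_field, iteratedDeriv_fun_mul (by fun_prop)
    (analyticAt_balancingFactor q (by simp)).contDiffAt, logPower]
  congr 1
  refine Finset.sum_congr rfl fun i _ => ?_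
  rw [iteratedDeriv_cexp_const_mul]
  simp

theorem hasDerivAt_logPower_zero (m : ℕ) {w : ℂ} (hw : w ∈ Complex.slitPlane) :
    HasDerivAt (logPower m 0) (m * (-Complex.log w) ^ (m - 1) * (-w⁻¹)) w := by
  have h : logPower m 0 = fun w => (-Complex.log w) ^ m := by
    funext w
    have h1 : ∀ n, iteratedDeriv n (balancingFactor 0) 0 = if n = 0 then 1 else 0 := fun n => by
      rw [iteratedDeriv_balancingFactor]
      rcases n with _ | n
      · simp [multipleHarmonic_zero_right]
      · simp [multipleHarmonic_zero_succ]
    rw [logPower, Finset.sum_range_succ, Finset.sum_eq_zero]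
    · simp [h1]
    · intro i hi
      have := Finset.mem_range.mp hi
      rw [h1, if_neg (by omega), mul_zero]
  rw [h]
  exact (Complex.hasDerivAt_log hw).neg.pow m

/-- At the level of generating functions, differentiating w^(q+1-x) gives the factor q+1-x, and
(q+1-x) Γ(x-q-1) = -Γ(x-q). The proof checks this identity on coefficients of powers of log w. -/
theorem hasDerivAt_logPower_succ (m q : ℕ) {w : ℂ} (hw : w ∈ Complex.slitPlane) :
    HasDerivAt (logPower m (q + 1)) (-logPower m q w) w := by
  have hw0 := Complex.slitPlane_ne_zero hw
  have hS : HasDerivAt (fun w => ∑ i ∈ Finset.range (m + 1), (m.choose i : ℂ) *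
      (-Complex.log w) ^ i * iteratedDeriv (m - i) (balancingFactor (q + 1)) 0)
      (∑ i ∈ Finset.range (m + 1), (m.choose i : ℂ) *
      (i * (-Complex.log w) ^ (i - 1) * (-w⁻¹)) *
        iteratedDeriv (m - i) (balancingFactor (q + 1)) 0) w :=
    HasDerivAt.fun_sum fun i _ =>
      (((Complex.hasDerivAt_log hw).neg.pow i).const_mul _).mul_const _
  have h := (hasDerivAt_pow (q + 1) w).mul hS
  refine h.congr_deriv ?_
  rw [logPower]
  set L := -Complex.log w
  have e1 : ∑ i ∈ Finset.range (m + 1), (m.choose i : ℂ) *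
      (i * L ^ (i - 1) * (-w⁻¹)) * iteratedDeriv (m - i) (balancingFactor (q + 1)) 0 =
      -w⁻¹ * ∑ i ∈ Finset.range m, (m.choose i : ℂ) * ((m - i : ℕ) : ℂ) * L ^ i *
        iteratedDeriv (m - (i + 1)) (balancingFactor (q + 1)) 0 := by
    rw [Finset.sum_range_succ', Finset.mul_sum]
    simp only [Nat.cast_zero, zero_mul, mul_zero, add_zero, Nat.add_sub_cancel]
    refine Finset.sum_congr rfl fun i hi => ?_
    have h1 : ((m.choose (i + 1) : ℂ)) * ((i + 1 : ℕ) : ℂ) = (m.choose i : ℂ) * ((m - i : ℕ) : ℂ) := by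
      exact_mod_cast Nat.choose_succ_right_eq m i
    linear_combination (L ^ i * (-w⁻¹) *
      iteratedDeriv (m - (i + 1)) (balancingFactor (q + 1)) 0) * h1
  have h0 : iteratedDeriv 0 (balancingFactor q) 0 =
      -((q : ℂ) + 1) * iteratedDeriv 0 (balancingFactor (q + 1)) 0 := by
    simp only [iteratedDeriv_zero]
    rw [balancingFactor_succ q (by simp)]
    ring
  have e2 : ∑ i ∈ Finset.range (m + 1), (m.choose i : ℂ) * L ^ i *
        iteratedDeriv (m - i) (balancingFactor q) 0 =
      -((q : ℂ) + 1) * ∑ i ∈ Finset.range (m + 1), (m.choose i : ℂ) * L ^ i *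
        iteratedDeriv (m - i) (balancingFactor (q + 1)) 0 +
      ∑ i ∈ Finset.range m, (m.choose i : ℂ) * ((m - i : ℕ) : ℂ) * L ^ i *
        iteratedDeriv (m - (i + 1)) (balancingFactor (q + 1)) 0 := by
    rw [Finset.sum_range_succ, Finset.sum_range_succ, Nat.sub_self, h0, mul_add, Finset.mul_sum,
      add_right_comm, ← Finset.sum_add_distrib]
    congr 1
    · refine Finset.sum_congr rfl fun i hi => ?_
      obtain ⟨n, hn⟩ : ∃ n, m - i = n + 1 :=
        ⟨m - i - 1, by have := Finset.mem_range.mp hi; omega⟩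
      have hn' : m - (i + 1) = n := by omega
      rw [hn, hn', iteratedDeriv_balancingFactor_succ_succ q n]
      push_cast
      ring
    · ring
  rw [e1, e2]
  simp only [Nat.add_sub_cancel]
  push_cast
  field_simp
  ring

end BarnesMilnor

/-! ### Expansion for k ≥ 0 and the size of the error -/

namespace BarnesMilnor

open Filter Topology MeasureTheory Set

theorem prod_add_mul_balancingFactor {k p : ℕ} (hp : p ≤ k) {x : ℂ} (hx : x.re < 1) :
    (∏ i ∈ Finset.range p, (x - k + i)) * balancingFactor k x = balancingFactor (k - p) x := by
  induction p with
  | zero => simp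
  | succ p ih =>
    obtain ⟨j, rfl⟩ : ∃ j, k = j + p + 1 := ⟨k - (p + 1), by omega⟩
    have h1 : j + p + 1 - p = j + 1 := by omega
    have h2 : j + p + 1 - (p + 1) = j := by omega
    rw [Finset.prod_range_succ, mul_right_comm, ih (by omega), h1, h2, balancingFactor_succ j hx]
    push_cast
    ring

/-- In Gamma notation, with N = n - r: Γ(x-k+N)/Γ(x-k) · Γ(x-k)/Γ(x) = Γ(x-q)/Γ(x), where q = r+k-n.
Here the balancing removes the separate dependence on k. -/
theorem gammaRatio_mul_balancingFactor {r k n : ℕ} (hn : n ≤ r + k) {x : ℂ} (hx : x.re < 1) :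
    gammaRatio ((n : ℤ) - r) (x - k) * balancingFactor k x = balancingFactor (r + k - n) x := by
  rcases le_or_gt r n with h | h
  · obtain ⟨p, rfl⟩ := Nat.exists_eq_add_of_le h
    have h1 : ((r + p : ℕ) : ℤ) - r = Int.ofNat p := by simp
    have h2 : r + k - (r + p) = k - p := by omega
    rw [h1, h2, ← prod_add_mul_balancingFactor (by omega) hx]
    rfl
  · obtain ⟨p, rfl⟩ := Nat.exists_eq_add_of_lt h
    have h1 : (n : ℤ) - ((n + p + 1 : ℕ) : ℤ) = Int.negSucc p := by
      rw [Int.negSucc_eq]; push_cast; ring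
    have h2 : n + p + 1 + k - n = k + (p + 1) := by omega
    rw [h1, h2, balancingFactor, balancingFactor, Finset.prod_range_add, mul_comm]
    simp only [gammaRatio]
    congr 1
    refine Finset.prod_congr rfl fun i _ => ?_
    push_cast
    ring

theorem inv_Gamma_sub_mul_balancingFactor (k : ℕ) {x : ℂ} (hx : x.re < 1) :
    (Complex.Gamma (x - k))⁻¹ * balancingFactor k x = (Complex.Gamma x)⁻¹ := by
  have h := prod_add_mul_balancingFactor (le_refl k) hx
  have h0 : balancingFactor 0 x = 1 := by simp [balancingFactor]
  rw [Nat.sub_self, h0] at h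
  rw [inv_Gamma_eq_prod_mul (x - k) k, sub_add_cancel]
  linear_combination (Complex.Gamma x)⁻¹ * h

variable {r : ℕ} {ω : Fin r → ℂ} {a c w : ℂ}

/-- The function of `x` whose `m`-th derivative at `0` is the error of the expansion. -/
noncomputable def errorGen (ω : Fin r → ℂ) (a c : ℂ) (k : ℕ) (w x : ℂ) : ℂ :=
  c ^ (x - k) * (Complex.Gamma x)⁻¹ * barnesIntegral ω a c (r + (k + 1)) w (x - k)

/-- The error of the expansion of `ₘP_{r,k}(w + a; ω)`. -/
noncomputable def errorTerm (m : ℕ) (ω : Fin r → ℂ) (a c : ℂ) (k : ℕ) (w : ℂ) : ℂ :=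
  iteratedDeriv m (errorGen ω a c k w) 0

theorem analyticAt_barnesIntegral (hc : c ≠ 0) (hω : ∀ i, 0 < (c * ω i).re)
    (hw : ‖c * a‖ + r < (c * w).re) (d : ℕ) {s : ℂ} (hs : -(d : ℝ) < s.re) :
    AnalyticAt ℂ (barnesIntegral ω a c (r + d) w) s := by
  obtain ⟨C, hC⟩ := expPowBound_barnesRemainder hω hc a d
  exact (hC.mellinClass hw).differentiableOn_mellin.analyticAt
    ((isOpen_lt continuous_const Complex.continuous_re).mem_nhds hs)

theorem analyticAt_barnesIntegral_sub (hc : c ≠ 0) (hω : ∀ i, 0 < (c * ω i).re)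
    (hw : ‖c * a‖ + r < (c * w).re) (k : ℕ) {x : ℂ} (hx : -1 < x.re) :
    AnalyticAt ℂ (fun x : ℂ => barnesIntegral ω a c (r + (k + 1)) w (x - k)) x := by
  refine AnalyticAt.fun_comp (g := barnesIntegral ω a c (r + (k + 1)) w)
    (f := fun x : ℂ => x - k) (analyticAt_barnesIntegral hc hω hw (k + 1) ?_) (by fun_prop)
  simp only [Complex.sub_re, Complex.natCast_re]
  push_cast
  linarith

theorem analyticAt_cpow_mul_inv_Gamma (hc : c ≠ 0) (k : ℕ) (x : ℂ) :
    AnalyticAt ℂ (fun x : ℂ => c ^ (x - k) * (Complex.Gamma x)⁻¹) x := by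
  refine Differentiable.analyticAt (fun x => ?_) x
  exact (DifferentiableAt.const_cpow (by fun_prop) (Or.inl hc)).mul
    (Complex.differentiable_one_div_Gamma x)

theorem analyticAt_errorGen (hc : c ≠ 0) (hω : ∀ i, 0 < (c * ω i).re)
    (hw : ‖c * a‖ + r < (c * w).re) (k : ℕ) {x : ℂ} (hx : -1 < x.re) :
    AnalyticAt ℂ (errorGen ω a c k w) x :=
  (analyticAt_cpow_mul_inv_Gamma hc k x).fun_mul (analyticAt_barnesIntegral_sub hc hω hw k hx)

/-- Removing r+k+1 Laurent terms keeps exactly the exponents q = r+k-n ≥ 0, and the remaining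
integral converges for Re x > -1, hence around x = 0. -/
theorem Admissible.balancedHyperGamma_eq (h : Admissible ω a c w) (m k : ℕ) :
    balancedHyperGamma m ω (k : ℤ) (w + a) =
      ∑ n ∈ Finset.range (r + (k + 1)),
        PowerSeries.coeff n (bernoulliSeries ω a) * logPower m (r + k - n) w +
      errorTerm m ω a c k w := by
  have hw0 : w ≠ 0 := fun h0 => by have := h.w_re; simp [h0] at this
  have hpole : ∀ {s : ℂ}, s.re < 1 → ∀ j : ℕ, 1 ≤ j → j ≤ r → s ≠ (j : ℂ) := by
    intro s hs j hj _ h0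
    rw [h0, Complex.natCast_re] at hs
    exact absurd hj (not_le.mpr (by exact_mod_cast hs))
  have hev : ∀ s : ℂ, -((k + 1 : ℕ) : ℝ) < s.re → s.re < 1 →
      barnesZeta ω (w + a) s = barnesContinuation ω a c (r + (k + 1)) w s :=
    fun s h1 h2 => h.barnesZeta_eq (k + 1) h1 (hpole h2)
  have hopen : IsOpen {s : ℂ | -((k + 1 : ℕ) : ℝ) < s.re ∧ s.re < 1} :=
    (isOpen_lt continuous_const Complex.continuous_re).inter
      (isOpen_lt Complex.continuous_re continuous_const)
  have han : AnalyticAt ℂ (barnesZeta ω (w + a)) (-(k : ℂ)) := by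
    refine DifferentiableOn.analyticAt (s := {s : ℂ | -((k + 1 : ℕ) : ℝ) < s.re ∧ s.re < 1})
      (DifferentiableOn.congr (fun s hs => (h.differentiableAt_barnesContinuation (k + 1) hs.1
        (hpole hs.2)).differentiableWithinAt) fun s hs => hev s hs.1 hs.2) (hopen.mem_nhds ?_)
    have : (0 : ℝ) ≤ k := by positivity
    constructor
    · simp
    · simp
      linarith
  have hG : ∀ q, AnalyticAt ℂ (fun x => w ^ ((q : ℕ) - x : ℂ) * balancingFactor q x) 0 := fun q => by
    refine AnalyticAt.fun_mul (Differentiable.analyticAt (fun x =>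
      DifferentiableAt.const_cpow (by fun_prop) (Or.inl hw0)) 0)
      (analyticAt_balancingFactor q (by simp))
  have hx : (fun x => barnesZeta ω (w + a) (x - k) * balancingFactor k x) =ᶠ[𝓝 0] fun x =>
      ∑ n ∈ Finset.range (r + (k + 1)), PowerSeries.coeff n (bernoulliSeries ω a) *
        (w ^ (((r + k - n : ℕ) : ℂ) - x) * balancingFactor (r + k - n) x) +
      errorGen ω a c k w x := by
    have h1 : {x : ℂ | -1 < x.re ∧ x.re < 1} ∈ 𝓝 (0 : ℂ) :=
      ((isOpen_lt continuous_const Complex.continuous_re).inter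
        (isOpen_lt Complex.continuous_re continuous_const)).mem_nhds
        (show -1 < (0 : ℂ).re ∧ (0 : ℂ).re < 1 by simp)
    filter_upwards [h1] with x hx
    have hx1 : -1 < x.re := hx.1
    have hk0 : (0 : ℝ) ≤ k := by positivity
    rw [hev _ (by simp; linarith) (by simp; linarith [hx.2]), barnesContinuation, errorGen, add_mul,
      Finset.sum_mul, ← inv_Gamma_sub_mul_balancingFactor k hx.2]
    congr 1
    · refine Finset.sum_congr rfl fun n hn => ?_
      have hn' : n ≤ r + k := by have := Finset.mem_range.mp hn; omega
      rw [← gammaRatio_mul_balancingFactor hn' hx.2, Nat.cast_sub hn']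
      have h2 : -(x - k + (((n : ℤ) - r : ℤ) : ℂ)) = ((r + k : ℕ) : ℂ) - n - x := by
        push_cast; ring
      rw [h2]
      ring
    · ring
  rw [balancedHyperGamma_natCast m ω k (w + a) han, hx.iteratedDeriv_eq,
    iteratedDeriv_fun_add (ContDiffAt.sum fun n _ => (analyticAt_const.fun_mul (hG _)).contDiffAt)
      (analyticAt_errorGen h.c_ne h.cω_re h.lt k (by simp)).contDiffAt,
    iteratedDeriv_fun_sum fun n _ => (analyticAt_const.fun_mul (hG _)).contDiffAt, errorTerm]
  congr 1
  refine Finset.sum_congr rfl fun n _ => ?_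
  rw [iteratedDeriv_const_mul_field, iteratedDeriv_cpow_mul_balancingFactor m _ hw0]

/-- Leibniz in x isolates the dependence on w in Mellin integrals with powers of log u, which are
Laplace integrals in c w. -/
theorem differentiableAt_errorTerm (m k : ℕ) (hc : c ≠ 0) (hω : ∀ i, 0 < (c * ω i).re)
    (hw : ‖c * a‖ + r < (c * w).re) : DifferentiableAt ℂ (errorTerm m ω a c k) w := by
  obtain ⟨C, hC⟩ := expPowBound_barnesRemainder hω hc a (k + 1)
  have hs : -((k + 1 : ℕ) : ℝ) < (-(k : ℂ)).re := by simp
  have hE : ∀ z : ℂ, ‖c * a‖ + r < (c * z).re → errorTerm m ω a c k z =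
      ∑ i ∈ Finset.range (m + 1), m.choose i *
        iteratedDeriv i (fun x : ℂ => c ^ (x - k) * (Complex.Gamma x)⁻¹) 0 *
        mellin (fun u : ℝ => Real.log u ^ (m - i) • (Complex.exp (-(c * z * u)) *
          barnesRemainder ω a (r + (k + 1)) (c * u))) (-k) := fun z hz => by
    have h1 : errorGen ω a c k z = fun x : ℂ => (c ^ (x - k) * (Complex.Gamma x)⁻¹) *
      barnesIntegral ω a c (r + (k + 1)) z (x - k) := rfl
    rw [errorTerm, h1, iteratedDeriv_fun_mul (analyticAt_cpow_mul_inv_Gamma hc k 0).contDiffAt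
      (analyticAt_barnesIntegral_sub hc hω hz k (by simp)).contDiffAt]
    refine Finset.sum_congr rfl fun i _ => ?_
    rw [iteratedDeriv_comp_sub_const]
    simp only [zero_sub]
    congr 1
    exact (hC.mellinClass hz).iteratedDeriv_mellin (m - i) hs
  have hev : ∀ᶠ z in 𝓝 w, ‖c * a‖ + r < (c * z).re :=
    (isOpen_lt continuous_const (Complex.continuous_re.comp (continuous_const_mul c))).mem_nhds hw
  refine DifferentiableAt.congr_of_eventuallyEq ?_ (hev.mono hE)
  refine DifferentiableAt.fun_sum fun i _ => DifferentiableAt.const_mul ?_ _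
  exact DifferentiableAt.fun_comp' (g := fun z : ℂ => mellin (fun u : ℝ => Real.log u ^ (m - i) •
    (Complex.exp (-(z * u)) * barnesRemainder ω a (r + (k + 1)) (c * u))) (-k)) w
    (hC.differentiableAt_mellin_log_pow (m - i) hs hw) (by fun_prop)

/-- The comparison function `(log |w|) ^ (m - 1) / |w|`. -/
noncomputable def gauge (m : ℕ) (w : ℂ) : ℝ :=
  Real.log ‖w‖ ^ m / (Real.log ‖w‖ * ‖w‖)

/-- The filter of large `w` with `η |w| ≤ Re (c w)`. -/
noncomputable def sectorFilter (c : ℂ) (η : ℝ) : Filter ℂ :=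
  Bornology.cobounded ℂ ⊓ 𝓟 {w : ℂ | η * ‖w‖ ≤ (c * w).re}

theorem eventually_sectorFilter {η : ℝ} {p : ℂ → Prop} :
    (∀ᶠ w in sectorFilter c η, p w) ↔
      ∃ R : ℝ, ∀ w : ℂ, R ≤ ‖w‖ → η * ‖w‖ ≤ (c * w).re → p w := by
  rw [sectorFilter, eventually_inf_principal, ← comap_norm_atTop, eventually_comap]
  constructor
  · intro h
    obtain ⟨R, hR⟩ := eventually_atTop.mp h
    exact ⟨R, fun w hw => hR ‖w‖ hw w rfl⟩
  · rintro ⟨R, hR⟩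
    exact eventually_atTop.mpr ⟨R, fun b hb w hw => hR w (hw ▸ hb)⟩

/-- Let L = log|w|. On the circle |x| = 1/L, 1/Γ(x) = x/Γ(x+1) is O(1/L), and |w|^(-Re x) ≤ e, so
the integral is O(1/|w|). Cauchy's estimate then multiplies by m! L^m. -/
theorem errorTerm_isBigO (m k : ℕ) (hc : c ≠ 0) (hω : ∀ i, 0 < (c * ω i).re) {η : ℝ}
    (hη : 0 < η) : errorTerm m ω a c k =O[sectorFilter c η] gauge m := by
  obtain ⟨C, hC⟩ := expPowBound_barnesRemainder hω hc a (k + 1)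
  have hC0 : 0 ≤ C := by
    have := (norm_nonneg _).trans (hC.bound 1 one_pos)
    rw [Real.one_rpow, one_mul] at this
    exact nonneg_of_mul_nonneg_left this (Real.exp_pos _)
  set B := ‖c * a‖ + r with hB
  have hB0 : 0 ≤ B := by positivity
  obtain ⟨K₁, hK₁⟩ : ∃ K₁, ∀ x ∈ Metric.closedBall (0 : ℂ) 1, ‖c ^ (x - k)‖ ≤ K₁ :=
    (isCompact_closedBall _ _).exists_bound_of_continuousOn (Continuous.continuousOn
      ((Differentiable.const_cpow (by fun_prop) (Or.inl hc)).continuous))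
  obtain ⟨K₂, hK₂⟩ : ∃ K₂, ∀ x ∈ Metric.closedBall (0 : ℂ) 1, ‖(Complex.Gamma (x + 1))⁻¹‖ ≤ K₂ :=
    (isCompact_closedBall _ _).exists_bound_of_continuousOn (Continuous.continuousOn
      (Complex.differentiable_one_div_Gamma.continuous.comp (by fun_prop)))
  obtain ⟨K₃, hK₃⟩ : ∃ K₃, ∀ x ∈ Icc (1 / 2 : ℝ) (3 / 2), ‖Real.Gamma x‖ ≤ K₃ :=
    isCompact_Icc.exists_bound_of_continuousOn (continuousOn_of_forall_continuousAt fun x hx =>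
      (Real.differentiableAt_Gamma fun n h => by
        have h1 := hx.1
        have : (0 : ℝ) ≤ n := by positivity
        linarith).continuousAt)
  -- Half of η absorbs the rate B; the cap at 1 makes θ^(-(Re x+1)) ≤ θ^(-2) on the circle.
  set θ := min (η / 2) 1 with hθ
  have hθ0 : 0 < θ := by positivity
  have hθ1 : θ ≤ 1 := min_le_right _ _
  have hK₁0 : 0 ≤ K₁ := (norm_nonneg _).trans (hK₁ 0 (by simp))
  have hK₂0 : 0 ≤ K₂ := (norm_nonneg _).trans (hK₂ 0 (by simp))
  have hK₃0 : 0 ≤ K₃ := (norm_nonneg _).trans (hK₃ 1 (by norm_num))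
  set K := K₁ * K₂ * (C * (θ ^ (-2 : ℝ) * Real.exp 1 * K₃)) with hK
  -- |w| ≥ e^2 makes the radius at most 1/2, so that Re x + 1 lies in [1/2, 3/2]. The other
  -- threshold gives B + 1 ≤ (η/2)|w|.
  refine IsBigO.of_bound (m.factorial * K) (eventually_sectorFilter.mpr
    ⟨max (Real.exp 2) (2 / η * (B + 1)), fun w hw1 hw2 => ?_⟩)
  have hwe : Real.exp 2 ≤ ‖w‖ := (le_max_left _ _).trans hw1
  have hw0 : 0 < ‖w‖ := (Real.exp_pos _).trans_le hwe
  set L := Real.log ‖w‖ with hL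
  have hL2 : 2 ≤ L := (Real.le_log_iff_exp_le hw0).mpr hwe
  have hL0 : 0 < L := by linarith
  have hy : θ * ‖w‖ ≤ (c * w).re - B := by
    have h1 : 2 / η * (B + 1) ≤ ‖w‖ := (le_max_right _ _).trans hw1
    have h2 : B + 1 ≤ η / 2 * ‖w‖ := by
      rw [div_mul_eq_mul_div, div_le_iff₀ hη] at h1
      linarith
    have h3 : θ * ‖w‖ ≤ η / 2 * ‖w‖ := by gcongr; exact min_le_left _ _
    linarith
  have hBw : B < (c * w).re := by
    have := mul_pos hθ0 hw0
    linarith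
  have hρ : L⁻¹ ≤ 1 / 2 := by
    rw [one_div]
    gcongr
  have hρ0 : 0 < L⁻¹ := by positivity
  have hmain : ∀ x ∈ Metric.sphere (0 : ℂ) L⁻¹, ‖errorGen ω a c k w x‖ ≤ L⁻¹ * (K / ‖w‖) := by
    intro x hx
    have hxn : ‖x‖ = L⁻¹ := by simpa using hx
    have hx1 : x ∈ Metric.closedBall (0 : ℂ) 1 := by
      rw [mem_closedBall_zero_iff, hxn]; linarith
    have hre := abs_le.mp ((Complex.abs_re_le_norm x).trans hxn.le)
    have hΓ : ‖(Complex.Gamma x)⁻¹‖ ≤ L⁻¹ * K₂ := by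
      rw [Complex.one_div_Gamma_eq_self_mul_one_div_Gamma_add_one, norm_mul, hxn]
      gcongr
      exact hK₂ x hx1
    have hs : -((k + 1 : ℕ) : ℝ) < (x - k).re := by
      simp only [Complex.sub_re, Complex.natCast_re]
      push_cast
      linarith [hre.1]
    have hI := hC.norm_mellin_le hBw hs
    have h1 : (x - k).re + ((k + 1 : ℕ) : ℝ) = x.re + 1 := by
      simp only [Complex.sub_re, Complex.natCast_re]
      push_cast
      ring
    rw [h1] at hI
    have h2 : Real.Gamma (x.re + 1) ≤ K₃ :=
      (Real.le_norm_self _).trans (hK₃ _ ⟨by linarith [hre.1], by linarith [hre.2]⟩)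
    have h3 : ((c * w).re - B) ^ (-(x.re + 1)) ≤ θ ^ (-2 : ℝ) * Real.exp 1 * ‖w‖⁻¹ := by
      calc ((c * w).re - B) ^ (-(x.re + 1)) ≤ (θ * ‖w‖) ^ (-(x.re + 1)) :=
            Real.rpow_le_rpow_of_nonpos (by positivity) hy (by linarith [hre.1])
        _ = θ ^ (-(x.re + 1)) * (‖w‖ ^ (-x.re) * ‖w‖⁻¹) := by
            rw [Real.mul_rpow hθ0.le hw0.le, neg_add, Real.rpow_add hw0, Real.rpow_neg_one]
        _ ≤ θ ^ (-2 : ℝ) * (Real.exp 1 * ‖w‖⁻¹) := by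
            have h4 : θ ^ (-(x.re + 1)) ≤ θ ^ (-2 : ℝ) :=
              Real.rpow_le_rpow_of_exponent_ge hθ0 hθ1 (by linarith [hre.2])
            have h5 : ‖w‖ ^ (-x.re) ≤ Real.exp 1 := by
              rw [Real.rpow_def_of_pos hw0]
              refine Real.exp_le_exp.mpr ?_
              calc L * -x.re ≤ L * L⁻¹ := by gcongr; linarith [hre.1]
                _ = 1 := mul_inv_cancel₀ hL0.ne'
            gcongr
        _ = _ := by ring
    have hΓ0 : 0 ≤ Real.Gamma (x.re + 1) := Real.Gamma_nonneg_of_nonneg (by linarith [hre.1])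
    rw [errorGen, norm_mul, norm_mul]
    calc _ ≤ K₁ * (L⁻¹ * K₂) * (C * ((θ ^ (-2 : ℝ) * Real.exp 1 * ‖w‖⁻¹) * K₃)) := by
          gcongr
          · exact hK₁ x hx1
          · refine hI.trans ?_
            gcongr
      _ = _ := by rw [hK, div_eq_mul_inv]; ring
  have hdiff : DiffContOnCl ℂ (errorGen ω a c k w) (Metric.ball 0 L⁻¹) := by
    refine DifferentiableOn.diffContOnCl fun x hx => ?_
    rw [closure_ball _ hρ0.ne', mem_closedBall_zero_iff] at hx
    have hre := abs_le.mp ((Complex.abs_re_le_norm x).trans hx)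
    exact (analyticAt_errorGen hc hω hBw k
      (by linarith [hre.1])).differentiableAt.differentiableWithinAt
  have hfin := Complex.norm_iteratedDeriv_le_of_forall_mem_sphere_norm_le m hρ0 hdiff hmain
  refine hfin.trans (le_of_eq ?_)
  rw [gauge, Real.norm_of_nonneg (by positivity), ← hL, inv_pow]
  field_simp

end BarnesMilnor

/-! ### Differentiation in w and negative indices -/

namespace BarnesMilnor

open Filter Topology MeasureTheory Set

variable {r : ℕ} {ω : Fin r → ℂ} {a c w : ℂ} {m : ℕ} {h : ℂ → ℂ}

/-- `h` is holomorphic for large `Re (c w)`, and `O((log |w|) ^ (m - 1) / |w|)` in the sectors around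
the direction of `c⁻¹`. -/
structure IsSmall (c : ℂ) (m : ℕ) (h : ℂ → ℂ) : Prop where
  diff : ∃ B : ℝ, ∀ w : ℂ, B < (c * w).re → DifferentiableAt ℂ h w
  bigO : ∀ η : ℝ, 0 < η → h =O[sectorFilter c η] gauge m

/-- For |w| ≥ 4 a unit displacement changes |w| and log|w| by factors between 1/2 and 2. -/
theorem gauge_le {z w : ℂ} (hw : 4 ≤ ‖w‖) (hz : ‖z - w‖ ≤ 1) :
    gauge m z ≤ 2 ^ m * 4 * gauge m w := by
  have h1 : ‖z‖ ≤ ‖w‖ + 1 := by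
    have := norm_sub_norm_le z w
    linarith
  have h2 : ‖w‖ - 1 ≤ ‖z‖ := by
    have := norm_sub_norm_le w z
    rw [norm_sub_rev] at this
    linarith
  have hw0 : 0 < ‖w‖ := by linarith
  have hz0 : 0 < ‖z‖ := by linarith
  set L := Real.log ‖w‖ with hL
  have hL4 : 2 * Real.log 2 ≤ L := by
    have h4 : Real.log (2 ^ 2) = 2 * Real.log 2 := by rw [Real.log_pow]; norm_num
    rw [← h4]
    exact Real.log_le_log (by norm_num) (by linarith)
  have hlog2 : 0 < Real.log 2 := Real.log_pos (by norm_num)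
  have hL0 : 0 < L := by linarith
  have h5 : Real.log ‖z‖ ≤ 2 * L := by
    have : Real.log ‖z‖ ≤ Real.log (2 * ‖w‖) := Real.log_le_log hz0 (by linarith)
    rw [Real.log_mul (by norm_num) hw0.ne'] at this
    linarith
  have h6 : L / 2 ≤ Real.log ‖z‖ := by
    have : Real.log (‖w‖ / 2) ≤ Real.log ‖z‖ := Real.log_le_log (by linarith) (by linarith)
    rw [Real.log_div hw0.ne' (by norm_num)] at this
    linarith
  have h7 : ‖w‖ / 2 ≤ ‖z‖ := by linarith
  have h8 : 0 < Real.log ‖z‖ := by linarith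
  rw [gauge, gauge, ← hL]
  calc Real.log ‖z‖ ^ m / (Real.log ‖z‖ * ‖z‖) ≤ (2 * L) ^ m / (L / 2 * (‖w‖ / 2)) := by gcongr
    _ = _ := by rw [mul_pow]; field_simp; norm_num

namespace IsSmall

/-- Cauchy's estimate on the unit disc about w. For large w the disc lies in the wider sector with
η/2, which is why the bound is required for every η. -/
theorem deriv (hh : IsSmall c m h) : IsSmall c m (deriv h) where
  diff := by
    obtain ⟨B, hB⟩ := hh.diff
    refine ⟨B, fun w hw => ?_⟩
    have hopen : IsOpen {w : ℂ | B < (c * w).re} :=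
      isOpen_lt continuous_const (Complex.continuous_re.comp (continuous_const_mul c))
    exact (DifferentiableOn.deriv (s := {w : ℂ | B < (c * w).re})
      (fun w hw => (hB w hw).differentiableWithinAt) hopen).differentiableAt (hopen.mem_nhds hw)
  bigO η hη := by
    obtain ⟨B, hB⟩ := hh.diff
    obtain ⟨K, hK0, hK⟩ := (hh.bigO (η / 2) (by positivity)).exists_pos
    obtain ⟨R, hR⟩ := eventually_sectorFilter.mp hK.bound
    refine IsBigO.of_bound (K * (2 ^ m * 4)) (eventually_sectorFilter.mpr
      -- On the unit disc about w, 4 serves the comparison of gauges, |R| + 1 keeps |z| ≥ R, and the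
      -- last threshold pays for the loss ‖c‖ in Re(c z).
      ⟨max (max 4 (|R| + 1)) (2 / η * (‖c‖ + η / 2 + |B|)), fun w hw1 hw2 => ?_⟩)
    have hw4 : 4 ≤ ‖w‖ := (le_max_left _ _).trans ((le_max_left _ _).trans hw1)
    have hwR : |R| + 1 ≤ ‖w‖ := (le_max_right _ _).trans ((le_max_left _ _).trans hw1)
    have hwη : ‖c‖ + η / 2 + |B| ≤ η / 2 * ‖w‖ := by
      have h1 := (le_max_right _ _).trans hw1
      rw [div_mul_eq_mul_div, div_le_iff₀ hη] at h1
      linarith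
    have hsec : ∀ z : ℂ, ‖z - w‖ ≤ 1 → R ≤ ‖z‖ ∧ η / 2 * ‖z‖ ≤ (c * z).re ∧ B < (c * z).re := by
      intro z hz
      have h1 : ‖z‖ ≤ ‖w‖ + 1 := by
        have := norm_sub_norm_le z w
        linarith
      have h2 : ‖w‖ - 1 ≤ ‖z‖ := by
        have := norm_sub_norm_le w z
        rw [norm_sub_rev] at this
        linarith
      have h3 : (c * w).re - ‖c‖ ≤ (c * z).re := by
        have h4 := (abs_le.mp (Complex.abs_re_le_norm (c * (z - w)))).1
        rw [norm_mul] at h4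
        have h5 : ‖c‖ * ‖z - w‖ ≤ ‖c‖ := mul_le_of_le_one_right (norm_nonneg _) hz
        have h6 : c * z = c * w + c * (z - w) := by ring
        rw [h6, Complex.add_re]
        linarith
      have h7 : η / 2 * ‖z‖ ≤ η / 2 * (‖w‖ + 1) := by gcongr
      have := le_abs_self R
      have := le_abs_self B
      have := norm_nonneg c
      have := abs_nonneg B
      exact ⟨by linarith, by linarith, by linarith⟩
    have hg0 : ∀ z : ℂ, ‖z - w‖ ≤ 1 → 0 ≤ gauge m z := fun z hz => by
      have h1 : 1 ≤ ‖z‖ := by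
        have := norm_sub_norm_le w z
        rw [norm_sub_rev] at this
        linarith
      have := Real.log_nonneg h1
      rw [gauge]
      positivity
    have hd : DiffContOnCl ℂ h (Metric.ball w 1) := by
      refine DifferentiableOn.diffContOnCl fun z hz => ?_
      rw [closure_ball _ one_ne_zero, mem_closedBall_iff_norm] at hz
      exact (hB z (hsec z hz).2.2).differentiableWithinAt
    have hb : ∀ z ∈ Metric.sphere w 1, ‖h z‖ ≤ K * (2 ^ m * 4 * gauge m w) := fun z hz => by
      have hz' : ‖z - w‖ ≤ 1 := (mem_sphere_iff_norm.mp hz).le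
      have h1 := hR z (hsec z hz').1 (hsec z hz').2.1
      rw [Real.norm_of_nonneg (hg0 z hz')] at h1
      refine h1.trans ?_
      gcongr
      exact gauge_le hw4 hz'
    have h2 := Complex.norm_deriv_le_of_forall_mem_sphere_norm_le one_pos hd hb
    rw [Real.norm_of_nonneg (hg0 w (by simp)), mul_assoc]
    simpa using h2

theorem iteratedDeriv (hh : IsSmall c m h) (n : ℕ) : IsSmall c m (iteratedDeriv n h) := by
  induction n with
  | zero => simpa using hh
  | succ n ih => simpa only [iteratedDeriv_succ] using ih.deriv

end IsSmall

theorem mem_slitPlane_of_re_pos (hc : 0 < c.re) (hw : 0 < (c * w).re) : w ∈ Complex.slitPlane := by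
  rw [Complex.mem_slitPlane_iff]
  by_contra! hcon
  rw [Complex.mul_re, hcon.2, mul_zero, sub_zero] at hw
  exact absurd hcon.1 (not_le.mpr (pos_of_mul_pos_right hw hc.le))

theorem norm_log_le (hw : Real.exp 1 ≤ ‖w‖) :
    ‖Complex.log w‖ ≤ (1 + Real.pi) * Real.log ‖w‖ := by
  have hL : 1 ≤ Real.log ‖w‖ := (Real.le_log_iff_exp_le ((Real.exp_pos 1).trans_le hw)).mpr hw
  have h1 := Complex.norm_le_abs_re_add_abs_im (Complex.log w)
  rw [Complex.log_re, Complex.log_im, abs_of_nonneg (by linarith)] at h1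
  have h2 := Complex.abs_arg_le_pi w
  nlinarith [Real.pi_pos]

theorem isBigO_log_pow_mul_inv (m : ℕ) (η : ℝ) :
    (fun w : ℂ => m * (-Complex.log w) ^ (m - 1) * (-w⁻¹)) =O[sectorFilter c η] gauge m := by
  rcases m with _ | m
  · simp only [Nat.cast_zero, zero_mul]
    exact isBigO_zero _ _
  refine IsBigO.of_bound ((m + 1) * (1 + Real.pi) ^ m)
    (eventually_sectorFilter.mpr ⟨Real.exp 1, fun w hw _ => ?_⟩)
  have hL : 1 ≤ Real.log ‖w‖ := (Real.le_log_iff_exp_le ((Real.exp_pos 1).trans_le hw)).mpr hw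
  have hL0 : 0 < Real.log ‖w‖ := by linarith
  have hw0 : 0 < ‖w‖ := (Real.exp_pos 1).trans_le hw
  rw [norm_mul, norm_mul, norm_neg, norm_inv, norm_pow, norm_neg, Complex.norm_natCast,
    Nat.add_sub_cancel, gauge, Real.norm_of_nonneg (by positivity)]
  calc ((m + 1 : ℕ) : ℝ) * ‖Complex.log w‖ ^ m * ‖w‖⁻¹ ≤
        ((m + 1 : ℕ) : ℝ) * ((1 + Real.pi) * Real.log ‖w‖) ^ m * ‖w‖⁻¹ := by
        gcongr
        exact norm_log_le hw
    _ = _ := by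
        rw [mul_pow]
        rw [pow_succ (Real.log ‖w‖)]
        push_cast
        field_simp

/-- log|w| ≤ |log w| ≤ (1+π) log|w| for large w. Both directions are used: L^m/L is compared factor
by factor, which also covers the exponent -1 at m = 0. -/
theorem gauge_isBigO (m : ℕ) :
    gauge m =O[Bornology.cobounded ℂ] (fun w : ℂ => Complex.log w ^ ((m : ℤ) - 1) / w) := by
  refine IsBigO.of_bound (1 + Real.pi)
    ((eventually_cobounded_le_norm (Real.exp 1)).mono fun w hw => ?_)
  have hL : 1 ≤ Real.log ‖w‖ := (Real.le_log_iff_exp_le ((Real.exp_pos 1).trans_le hw)).mpr hw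
  have hL0 : 0 < Real.log ‖w‖ := by linarith
  have hw0 : 0 < ‖w‖ := (Real.exp_pos 1).trans_le hw
  have h1 : Real.log ‖w‖ ≤ ‖Complex.log w‖ := by
    have := Complex.abs_re_le_norm (Complex.log w)
    rw [Complex.log_re] at this
    exact (le_abs_self _).trans this
  have h2 : Complex.log w ≠ 0 := norm_pos_iff.mp (hL0.trans_le h1)
  have h3 : 0 < ‖Complex.log w‖ := norm_pos_iff.mpr h2
  have h4 := norm_log_le hw
  rw [zpow_sub_one₀ h2, zpow_natCast, norm_div, norm_mul, norm_pow, norm_inv, gauge,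
    Real.norm_of_nonneg (by positivity)]
  have h5 : (Real.log ‖w‖)⁻¹ ≤ (1 + Real.pi) * ‖Complex.log w‖⁻¹ := by
    rw [← div_eq_mul_inv, inv_eq_one_div, div_le_div_iff₀ hL0 h3, one_mul]
    exact h4
  calc Real.log ‖w‖ ^ m / (Real.log ‖w‖ * ‖w‖) =
        Real.log ‖w‖ ^ m * (Real.log ‖w‖)⁻¹ * ‖w‖⁻¹ := by field_simp
    _ ≤ ‖Complex.log w‖ ^ m * ((1 + Real.pi) * ‖Complex.log w‖⁻¹) * ‖w‖⁻¹ := by gcongr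
    _ = _ := by ring

theorem analyticAt_logPower (m q : ℕ) (hw : w ∈ Complex.slitPlane) :
    AnalyticAt ℂ (logPower m q) w := by
  refine DifferentiableOn.analyticAt (s := Complex.slitPlane) (fun z hz => ?_)
    (Complex.isOpen_slitPlane.mem_nhds hw)
  rcases q with _ | q
  · exact (hasDerivAt_logPower_zero m hz).differentiableAt.differentiableWithinAt
  · exact (hasDerivAt_logPower_succ m q hz).differentiableAt.differentiableWithinAt

theorem iteratedDeriv_logPower (m : ℕ) {q j : ℕ} (hj : j ≤ q) (hw : w ∈ Complex.slitPlane) :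
    iteratedDeriv j (logPower m q) w = (-1) ^ j * logPower m (q - j) w := by
  induction j generalizing w with
  | zero => simp
  | succ j ih =>
    obtain ⟨i, rfl⟩ : ∃ i, q = i + j + 1 := ⟨q - (j + 1), by omega⟩
    have h1 : i + j + 1 - j = i + 1 := by omega
    have h2 : i + j + 1 - (j + 1) = i := by omega
    have hev : iteratedDeriv j (logPower m (i + j + 1)) =ᶠ[𝓝 w]
        fun w => (-1) ^ j * logPower m (i + 1) w := by
      filter_upwards [Complex.isOpen_slitPlane.mem_nhds hw] with z hz
      rw [ih (by omega) hz, h1]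
    rw [iteratedDeriv_succ, hev.deriv_eq, ((hasDerivAt_logPower_succ m i hw).const_mul _).deriv, h2]
    ring

/-- After q derivatives only ±(-log w)^m is left; one more gives a multiple of (log w)^(m-1)/w, and
further ones stay small. -/
theorem isSmall_iteratedDeriv_logPower (m : ℕ) {q j : ℕ} (hc : 0 < c.re) (hj : q < j) :
    IsSmall c m (iteratedDeriv j (logPower m q)) := by
  obtain ⟨e, rfl⟩ : ∃ e, j = e + (q + 1) := ⟨j - (q + 1), by omega⟩
  have heq : ∀ w ∈ Complex.slitPlane, iteratedDeriv (q + 1) (logPower m q) w =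
      (-1) ^ q * (m * (-Complex.log w) ^ (m - 1) * (-w⁻¹)) := fun w hw => by
    have hev : iteratedDeriv q (logPower m q) =ᶠ[𝓝 w] fun w => (-1) ^ q * logPower m 0 w := by
      filter_upwards [Complex.isOpen_slitPlane.mem_nhds hw] with z hz
      rw [iteratedDeriv_logPower m le_rfl hz, Nat.sub_self]
    rw [iteratedDeriv_succ, hev.deriv_eq, ((hasDerivAt_logPower_zero m hw).const_mul _).deriv]
  have hsmall : IsSmall c m (iteratedDeriv (q + 1) (logPower m q)) := by
    refine ⟨⟨0, fun w hw => ?_⟩, fun η hη => ?_⟩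
    · have hw' := mem_slitPlane_of_re_pos hc hw
      rw [iteratedDeriv_eq_iterate]
      exact ((analyticAt_logPower m q hw').iterated_deriv (q + 1)).differentiableAt
    · refine ((isBigO_log_pow_mul_inv m η).const_mul_left ((-1) ^ q)).congr' ?_ EventuallyEq.rfl
      refine eventually_sectorFilter.mpr ⟨1, fun w hw1 hw2 => (heq w ?_).symm⟩
      exact mem_slitPlane_of_re_pos hc (lt_of_lt_of_le (by positivity) hw2)
  have h1 : iteratedDeriv (e + (q + 1)) (logPower m q) =
      iteratedDeriv e (iteratedDeriv (q + 1) (logPower m q)) := by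
    simp only [iteratedDeriv_eq_iterate, Function.iterate_add_apply]
  rw [h1]
  exact hsmall.iteratedDeriv e

theorem isSmall_errorTerm (m k : ℕ) (hc : c ≠ 0) (hω : ∀ i, 0 < (c * ω i).re) (a : ℂ) :
    IsSmall c m (errorTerm m ω a c k) :=
  ⟨⟨_, fun _ hw => differentiableAt_errorTerm m k hc hω hw⟩,
    fun _ hη => errorTerm_isBigO m k hc hω hη⟩

theorem eventually_admissible (hc : 0 < c.re) (hω : ∀ i, 0 < (ω i).re)
    (hcω : ∀ i, 0 < (c * ω i).re) (ha : 0 ≤ a.re) {η : ℝ} (hη : 0 < η) :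
    ∀ᶠ w in sectorFilter c η ⊓ 𝓟 {w : ℂ | 0 < w.re}, Admissible ω a c w := by
  rw [eventually_inf_principal]
  refine eventually_sectorFilter.mpr ⟨η⁻¹ * (‖c * a‖ + r + 1), fun w hw1 hw2 hw3 =>
    ⟨hc, hw3, hω, hcω, ha, ?_⟩⟩
  rw [inv_mul_le_iff₀ hη] at hw1
  linarith

theorem Admissible.eventually_nhds (h : Admissible ω a c w) :
    ∀ᶠ z in 𝓝 w, Admissible ω a c z := by
  filter_upwards [(isOpen_lt continuous_const Complex.continuous_re).mem_nhds h.w_re,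
    (isOpen_lt continuous_const (Complex.continuous_re.comp (continuous_const_mul c))).mem_nhds h.lt]
    with z hz1 hz2
  exact ⟨h.c_re, hz1, h.ω_re, h.cω_re, h.a_re, hz2⟩

theorem Admissible.balancedHyperGamma_negSucc_eq (h : Admissible ω a c w) (m j : ℕ) :
    balancedHyperGamma m ω (Int.negSucc j) (w + a) =
      (-1) ^ (j + 1) * (∑ n ∈ Finset.range (r + 1), PowerSeries.coeff n (bernoulliSeries ω a) *
        iteratedDeriv (j + 1) (logPower m (r - n)) w +
          iteratedDeriv (j + 1) (errorTerm m ω a c 0) w) := by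
  have h0 : balancedHyperGamma m ω (Int.negSucc j) (w + a) = (-1) ^ (j + 1) *
      iteratedDeriv (j + 1) (fun z => balancedHyperGamma m ω ((0 : ℕ) : ℤ) (z + a)) w := by
    rw [iteratedDeriv_comp_add_const]
    rfl
  have hw' := mem_slitPlane_of_re_pos h.c_re h.cw_re
  have hE : AnalyticAt ℂ (errorTerm m ω a c 0) w :=
    DifferentiableOn.analyticAt (s := {w : ℂ | ‖c * a‖ + r < (c * w).re})
      (fun z hz => (differentiableAt_errorTerm m 0 h.c_ne h.cω_re hz).differentiableWithinAt)
      ((isOpen_lt continuous_const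
        (Complex.continuous_re.comp (continuous_const_mul c))).mem_nhds h.lt)
  have hev : (fun z => balancedHyperGamma m ω ((0 : ℕ) : ℤ) (z + a)) =ᶠ[𝓝 w] fun z =>
      ∑ n ∈ Finset.range (r + 1),
        PowerSeries.coeff n (bernoulliSeries ω a) * logPower m (r - n) z +
      errorTerm m ω a c 0 z := by
    filter_upwards [h.eventually_nhds] with z hz
    exact hz.balancedHyperGamma_eq m 0
  have hL : ∀ n, ContDiffAt ℂ (j + 1 : ℕ) (fun z => PowerSeries.coeff n (bernoulliSeries ω a) *
      logPower m (r - n) z) w := fun n =>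
    (analyticAt_const.fun_mul (analyticAt_logPower m (r - n) hw')).contDiffAt
  rw [h0, hev.iteratedDeriv_eq, iteratedDeriv_fun_add (ContDiffAt.sum fun n _ => hL n)
    hE.contDiffAt, iteratedDeriv_fun_sum fun n _ => hL n]
  simp only [iteratedDeriv_const_mul_field]

/-- The expansion of `ₘP_{r,k}(w + a; ω)` in powers of `w` and `log w`, in a sector. -/
theorem balancedHyperGamma_sub_isBigO (m : ℕ) (k : ℤ) (hc : 0 < c.re) (hω : ∀ i, 0 < (ω i).re)
    (hcω : ∀ i, 0 < (c * ω i).re) (ha : 0 ≤ a.re) {η : ℝ} (hη : 0 < η) :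
    (fun w => balancedHyperGamma m ω k (w + a) - ∑ n ∈ Finset.range ((r : ℤ) + k + 1).toNat,
      PowerSeries.coeff n (bernoulliSeries ω a) *
        logPower m (((r : ℤ) + k + 1).toNat - 1 - n) w)
      =O[sectorFilter c η ⊓ 𝓟 {w : ℂ | 0 < w.re}] gauge m := by
  have hadm := eventually_admissible hc hω hcω ha hη
  have hc0 : c ≠ 0 := fun h => by simp [h] at hc
  rcases k with k | j
  · have hT : ((r : ℤ) + Int.ofNat k + 1).toNat = r + (k + 1) := by
      simp only [Int.ofNat_eq_natCast]; omega
    rw [hT]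
    refine (((isSmall_errorTerm m k hc0 hcω a).bigO η hη).mono inf_le_left).congr' ?_
      EventuallyEq.rfl
    filter_upwards [hadm] with w hw
    exact (sub_eq_of_eq_add' (hw.balancedHyperGamma_eq m k)).symm
  · have hT : ((r : ℤ) + Int.negSucc j + 1).toNat = r - j := by
      rw [Int.negSucc_eq]; omega
    rw [hT]
    -- After j + 1 derivatives the terms with n < r - j remain model functions; the others are
    -- differentiated past q = 0 and join the error. Truncated subtraction covers r ≤ j, where no
    -- main term is left.
    have hterm : ∀ n ∈ Finset.range (r + 1), (fun w =>
        (-1) ^ (j + 1) * (PowerSeries.coeff n (bernoulliSeries ω a) *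
          iteratedDeriv (j + 1) (logPower m (r - n)) w) -
        if n < r - j then PowerSeries.coeff n (bernoulliSeries ω a) *
          logPower m (r - j - 1 - n) w else 0)
        =O[sectorFilter c η ⊓ 𝓟 {w : ℂ | 0 < w.re}] gauge m := fun n hn => by
      by_cases hnj : n < r - j
      · refine (isBigO_zero _ _).congr' ?_ EventuallyEq.rfl
        filter_upwards [hadm] with w hw
        have hw' := mem_slitPlane_of_re_pos hw.c_re hw.cw_re
        have h1 : r - n - (j + 1) = r - j - 1 - n := by omega
        have h2 : ((-1 : ℂ) ^ (j + 1)) * (-1) ^ (j + 1) = 1 := by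
          rw [← mul_pow]; simp
        rw [if_pos hnj, iteratedDeriv_logPower m (by omega) hw', h1]
        linear_combination (-(PowerSeries.coeff n (bernoulliSeries ω a) *
          logPower m (r - j - 1 - n) w)) * h2
      · simp only [if_neg hnj, sub_zero]
        exact ((((isSmall_iteratedDeriv_logPower m hc (by omega)).bigO η hη).const_mul_left
          _).const_mul_left _).mono inf_le_left
    have herr := ((((isSmall_errorTerm m 0 hc0 hcω a).iteratedDeriv (j + 1)).bigO η
      hη).const_mul_left ((-1) ^ (j + 1))).mono
      (inf_le_left (a := sectorFilter c η) (b := 𝓟 {w : ℂ | 0 < w.re}))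
    refine ((IsBigO.fun_sum hterm).add herr).congr' ?_ EventuallyEq.rfl
    filter_upwards [hadm] with w hw
    have hsub : Finset.range (r - j) ⊆ Finset.range (r + 1) :=
      Finset.range_subset_range.mpr (by omega)
    have hfil : (Finset.range (r + 1)).filter (· < r - j) = Finset.range (r - j) := by
      ext n
      simp only [Finset.mem_filter, Finset.mem_range]
      omega
    rw [hw.balancedHyperGamma_negSucc_eq m j, Finset.sum_sub_distrib, ← Finset.mul_sum,
      ← Finset.sum_filter, hfil]
    ring

/-! ### Tilted rays and comparison of the two expansions -/

theorem exists_direction {r : ℕ} {ω : Fin r → ℂ} (hω : ∀ i, 0 < (ω i).re) (σ : ℝ) :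
    ∃ ε : ℝ, 0 < ε ∧ ε ≤ 1 ∧ ∀ i, 0 < ((1 - (σ * ε : ℝ) * Complex.I) * ω i).re := by
  have h1 : ∀ᶠ ε : ℝ in 𝓝[>] 0, ∀ i, 0 < ((1 - (σ * ε : ℝ) * Complex.I) * ω i).re := by
    refine eventually_all.mpr fun i => ?_
    have hcont : Continuous fun ε : ℝ => ((1 - (σ * ε : ℝ) * Complex.I) * ω i).re := by fun_prop
    refine ((hcont.tendsto 0).mono_left nhdsWithin_le_nhds).eventually_const_lt ?_
    simpa using hω i
  obtain ⟨ε, h, h'⟩ := (h1.and (Ioc_mem_nhdsGT one_pos)).exists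
  exact ⟨ε, h'.1, h'.2, h⟩

/-- The left side is expanded with shift a, each term on the right with shift 0. The difference of
the main terms vanishes, leaving a finite combination of errors. -/
theorem balancedHyperGamma_expansion_of_direction {l : ℕ} {α : Fin l → ℂ} (m : ℕ) (k : ℤ)
    (hc : 0 < c.re) (hω : ∀ i, 0 < (ω i).re) (hα : ∀ i, 0 < (α i).re)
    (hcω : ∀ i, 0 < (c * ω i).re) (hcα : ∀ i, 0 < (c * α i).re) (ha : 0 ≤ a.re) {η : ℝ}
    (hη : 0 < η) :
    (fun w : ℂ => balancedHyperGamma m (Fin.append ω α) k (w + a) -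
        ∑ N ∈ Finset.Icc (-(l : ℤ)) ((r : ℤ) + k),
          multipleBernoulli α N a * balancedHyperGamma m ω (k - N) w)
      =O[sectorFilter c η ⊓ 𝓟 {w : ℂ | 0 < w.re}] gauge m := by
  have happ : ∀ p : ℂ → Prop, (∀ i, p (ω i)) → (∀ i, p (α i)) → ∀ i, p (Fin.append ω α i) := by
    intro p h1 h2 i
    induction i using Fin.addCases with
    | left i => simpa using h1 i
    | right i => simpa using h2 i
  have hα0 : ∀ i, α i ≠ 0 := fun i h => by have := hα i; simp [h] at this
  have h1 := balancedHyperGamma_sub_isBigO (ω := Fin.append ω α) m k hc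
    (happ (fun z => 0 < z.re) hω hα) (happ (fun z => 0 < (c * z).re) hcω hcα) ha hη
  have h2 : (fun w : ℂ => ∑ N ∈ Finset.Icc (-(l : ℤ)) ((r : ℤ) + k), multipleBernoulli α N a *
      (balancedHyperGamma m ω (k - N) (w + 0) -
        ∑ n ∈ Finset.range ((r : ℤ) + (k - N) + 1).toNat,
          PowerSeries.coeff n (bernoulliSeries ω 0) *
            logPower m (((r : ℤ) + (k - N) + 1).toNat - 1 - n) w))
      =O[sectorFilter c η ⊓ 𝓟 {w : ℂ | 0 < w.re}] gauge m :=
    IsBigO.fun_sum fun N _ => (balancedHyperGamma_sub_isBigO m (k - N) hc hω hcω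
      (by simp) hη).const_mul_left _
  refine (h1.sub h2).congr_left fun w => ?_
  set T := (((r + l : ℕ) : ℤ) + k + 1).toNat with hT
  have key : ∑ n ∈ Finset.range T, PowerSeries.coeff n (bernoulliSeries (Fin.append ω α) a) *
      logPower m (T - 1 - n) w =
      ∑ N ∈ Finset.Icc (-(l : ℤ)) ((r : ℤ) + k), multipleBernoulli α N a *
        ∑ n ∈ Finset.range ((r : ℤ) + (k - N) + 1).toNat,
          PowerSeries.coeff n (bernoulliSeries ω 0) *
            logPower m (((r : ℤ) + (k - N) + 1).toNat - 1 - n) w := by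
    -- The substitution N = j - l makes the double sum run over j + n < T, with model index T - 1 -
    -- (j + n). Summing along diagonals gives the Cauchy product.
    have e1 : ∑ N ∈ Finset.Icc (-(l : ℤ)) ((r : ℤ) + k), multipleBernoulli α N a *
        ∑ n ∈ Finset.range ((r : ℤ) + (k - N) + 1).toNat,
          PowerSeries.coeff n (bernoulliSeries ω 0) *
            logPower m (((r : ℤ) + (k - N) + 1).toNat - 1 - n) w =
        ∑ j ∈ Finset.range T, ∑ n ∈ Finset.range (T - j),
          PowerSeries.coeff j (bernoulliSeries α a) * PowerSeries.coeff n (bernoulliSeries ω 0) *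
            logPower m (T - 1 - (j + n)) w := by
      refine Finset.sum_bij' (fun N _ => (N + l).toNat) (fun j _ => (j : ℤ) - l) ?_ ?_ ?_ ?_ ?_
      · intro N hN
        rw [Finset.mem_Icc] at hN
        rw [Finset.mem_range]
        omega
      · intro j hj
        rw [Finset.mem_range] at hj
        rw [Finset.mem_Icc]
        omega
      · intro N hN
        rw [Finset.mem_Icc] at hN
        omega
      · intro j hj
        omega
      · intro N hN
        rw [Finset.mem_Icc] at hN
        obtain ⟨j, hj⟩ : ∃ j : ℕ, N = (j : ℤ) - l := ⟨(N + l).toNat, by omega⟩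
        have hj' : (N + l).toNat = j := by omega
        have hTj : ((r : ℤ) + (k - N) + 1).toNat = T - j := by omega
        rw [hj', hTj, hj, multipleBernoulli_eq_coeff hα0, Finset.mul_sum]
        refine Finset.sum_congr rfl fun n _ => ?_
        have : T - j - 1 - n = T - 1 - (j + n) := by omega
        rw [this, mul_assoc]
    rw [e1, ← Finset.sum_range_diag_flip T fun j n =>
      PowerSeries.coeff j (bernoulliSeries α a) * PowerSeries.coeff n (bernoulliSeries ω 0) *
        logPower m (T - 1 - (j + n)) w]
    refine Finset.sum_congr rfl fun n _ => ?_
    rw [bernoulliSeries_append, mul_comm (bernoulliSeries ω 0), PowerSeries.coeff_mul,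
      Finset.Nat.sum_antidiagonal_eq_sum_range_succ fun i j =>
        PowerSeries.coeff i (bernoulliSeries α a) * PowerSeries.coeff j (bernoulliSeries ω 0),
      Finset.sum_mul]
    refine Finset.sum_congr rfl fun i hi => ?_
    have : i + (n - i) = n := by have := Finset.mem_range.mp hi; omega
    rw [this]
  simp only [add_zero, mul_sub, Finset.sum_sub_distrib]
  rw [key]
  ring

/-- With w = x + iy and x, y ≥ 0, Re((1 - iε)w) = x + εy ≥ ε(x + y) ≥ ε|w| because ε ≤ 1; the
conjugate tilt handles y ≤ 0. -/
theorem cobounded_inf_le {ε₁ ε₂ : ℝ} (h₁ : 0 < ε₁) (h₁' : ε₁ ≤ 1) (h₂ : 0 < ε₂) (h₂' : ε₂ ≤ 1) :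
    Bornology.cobounded ℂ ⊓ 𝓟 {w : ℂ | 0 < w.re} ≤
      sectorFilter (1 - (1 * ε₁ : ℝ) * Complex.I) ε₁ ⊓ 𝓟 {w : ℂ | 0 < w.re} ⊔
      sectorFilter (1 - ((-1) * ε₂ : ℝ) * Complex.I) ε₂ ⊓ 𝓟 {w : ℂ | 0 < w.re} := by
  rw [sectorFilter, sectorFilter, inf_assoc, inf_assoc, inf_principal, inf_principal,
    ← inf_sup_left, sup_principal]
  refine inf_le_inf_left _ (principal_mono.mpr fun w hw => ?_)
  have hw' : 0 < w.re := hw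
  have hn := Complex.norm_le_abs_re_add_abs_im w
  rw [abs_of_pos hw'] at hn
  rcases le_total 0 w.im with him | him
  · refine Or.inl ⟨?_, hw⟩
    rw [abs_of_nonneg him] at hn
    simp
    nlinarith
  · refine Or.inr ⟨?_, hw⟩
    rw [abs_of_nonpos him] at hn
    simp
    nlinarith

end BarnesMilnor

theorem theorem1p4 (m r l : ℕ) (k : ℤ) (ω : Fin r → ℂ) (α : Fin l → ℂ) (a : ℂ)
    (hω : ∀ i, 0 < (ω i).re) (hα : ∀ j, 0 < (α j).re) (ha : 0 ≤ a.re) :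
    (fun w : ℂ =>
        BarnesMilnor.balancedHyperGamma m (Fin.append ω α) k (w + a) -
          ∑ N ∈ Finset.Icc (-(l : ℤ)) ((r : ℤ) + k),
            BarnesMilnor.multipleBernoulli α N a *
              BarnesMilnor.balancedHyperGamma m ω (k - N) w)
      =O[Bornology.cobounded ℂ ⊓ Filter.principal {w : ℂ | 0 < w.re}]
        (fun w : ℂ => Complex.log w ^ ((m : ℤ) - 1) / w) := by
  have hdir : ∀ σ : ℝ, ∃ ε : ℝ, 0 < ε ∧ ε ≤ 1 ∧
      (∀ i, 0 < ((1 - (σ * ε : ℝ) * Complex.I) * ω i).re) ∧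
      ∀ i, 0 < ((1 - (σ * ε : ℝ) * Complex.I) * α i).re := fun σ => by
    obtain ⟨ε, h1, h2, h3⟩ := BarnesMilnor.exists_direction (ω := Fin.append ω α) (fun i => by
      induction i using Fin.addCases with
      | left i => simpa using hω i
      | right i => simpa using hα i) σ
    exact ⟨ε, h1, h2, fun i => by simpa using h3 (Fin.castAdd l i),
      fun i => by simpa using h3 (Fin.natAdd r i)⟩
  obtain ⟨ε₁, h1, h1', hω1, hα1⟩ := hdir 1
  obtain ⟨ε₂, h2, h2', hω2, hα2⟩ := hdir (-1)
  have hre : ∀ x : ℝ, 0 < (1 - (x : ℂ) * Complex.I).re := fun x => by simp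
  have e1 := BarnesMilnor.balancedHyperGamma_expansion_of_direction m k (hre _) hω hα hω1 hα1 ha h1
  have e2 := BarnesMilnor.balancedHyperGamma_expansion_of_direction m k (hre _) hω hα hω2 hα2 ha h2
  exact ((e1.sup e2).mono (BarnesMilnor.cobounded_inf_le h1 h1' h2 h2')).trans
    ((BarnesMilnor.gauge_isBigO m).mono inf_le_left)
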